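/- Let $d,p\in\mathbb N=\{1,2,\dots\}$. A convex body is a compact convex subset of $\mathbb R^d$ with non-empty interior. For a vector $r=(r_1,\dots,r_d)$ and $A\subseteq\mathbb R^d$ write $rA=\{(r_1a_1,\dots,r_da_d): a\in A\}$ and $r^{-1}=(r_1^{-1},\dots,r_d^{-1})$. For each $n\in\mathbb N$ let $C_n=\bigcup_{i=1}^p C_{n,i}$ with convex bodies $C_{n,1},\dots,C_{n,p}$, let $D_n=C_n\cap\mathbb Z^d$, and let $c_n=(c_{n,1},\dots,c_{n,d})$ be a vector with $0<c_{n,\ell}<\infty$, such that $|C_n|\to\infty$, $c_{n,\ell}\to\infty$ for every $\ell$, and $c_{n,1}\cdots c_{n,d}\sim|C_n|$ as $n\to\infty$. Here $|\cdot|$ is Lebesgue measure for subsets of $\mathbb R^d$ and the number of points for discrete sets. Consider the condition (B) there is $0<b<\infty$ such that $C_n\subseteq c_n[-b,b]^d$ for all $n$. Call a sequence $(k_n)$ of positive integers admissible if $k_n\to\infty$ and $k_n^{1/d}=o(c_{n,\ell})$ for each $\ell$. For such a sequence let $t_{n}^\ell=\lfloor c_{n,\ell}/k_n^{1/d}\rfloor$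 and, for $z\in\mathbb Z^d$, $I_z^{n,k_n}=\prod_{\ell=1}^d[z_\ell t_n^\ell,(z_\ell+1)t_n^\ell)$. Let $p_{n,k_n}$ be the number of $z\in\mathbb Z^d$ with $I_z^{n,k_n}\subseteq C_n$, let $q_{n,k_n}$ be the number of $z\in\mathbb Z^d$ with $I_z^{n,k_n}\cap C_n\ne\emptyset$ (both are finite for all sufficiently large $n$), and let $D_{n,k_n}^+$ be the union of the sets $I_z^{n,k_n}\cap\mathbb Z^d$ over all $z$ with $I_z^{n,k_n}\cap C_n\neq\emptyset$. If (B) holds, then: (i) $|D_n|\sim|C_n|$ as $n\to\infty$; (ii) for every admissible $(k_n)$, $\displaystyle\lim_{n\to\infty}\frac{p_{n,k_n}}{k_n}=\lim_{n\to\infty}\frac{q_{n,k_n}}{k_n}=1$; (iii) there is $0<c<\infty$, not depending on $(k_n)$, such that with $K_n=\mathbb Z^d\cap c_n[-c,c]^d$ one has $D_{n,k_n}^+\subseteq K_n$ for all $n\in\mathbb N$ and every admissible $(k_n)$. Let $V_j$ denote the $j$th intrinsic volume, that is, for a convex body $K$ the numbers $V_0(K),\dots,V_d(K)$ are determined by the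 Steiner formula $|K+rB|=\sum_{j=0}^d\omega_{d-j}V_j(K)r^{d-j}$ for all $r\ge0$, where $B$ is the closed Euclidean unit ball and $\omega_m$ the volume of the $m$-dimensional unit ball. Consider the condition (V) for each $j=1,\dots,d-1$ the sequence $\sum_{i=1}^pV_j(c_n^{-1}C_{n,i})$ is bounded in $n$. Then (B) implies (V). If moreover every $C_n$ is connected and $0\in D_n$ for every $n$, then (B) and (V) are equivalent; in particular (V) then implies (i)–(iii). -/

import Mathlib

open Filter Topology Asymptotics MeasureTheory
open scoped Pointwise

noncomputable section

namespace SpatialIndex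

/-- `d`-dimensional Euclidean space. -/
abbrev E (d : ℕ) : Type := EuclideanSpace ℝ (Fin d)

/-- A convex body: a compact convex set with non-empty interior. -/
structure IsConvexBody {d : ℕ} (K : Set (E d)) : Prop where
  isCompact : IsCompact K
  convex : Convex ℝ K
  interior_nonempty : (interior K).Nonempty

/-- The coordinate-wise scaling `r A = {(r₁ a₁, …, r_d a_d) : a ∈ A}`. -/
def coordScale {d : ℕ} (r : Fin d → ℝ) (A : Set (E d)) : Set (E d) :=
  (fun a : E d => WithLp.toLp 2 (fun l => r l * a l)) '' A

/-- The cube `[-b, b]^d`. -/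
def cube (d : ℕ) (b : ℝ) : Set (E d) := {x | ∀ l, x l ∈ Set.Icc (-b) b}

/-- The points of the integer lattice that lie in `A`, i.e. `A ∩ ℤ^d`. -/
def latticePoints {d : ℕ} (A : Set (E d)) : Set (Fin d → ℤ) :=
  {v | (WithLp.toLp 2 (fun l => (v l : ℝ)) : E d) ∈ A}

/-! ### Intrinsic volumes -/

/-- The volume of the `m`-dimensional Euclidean unit ball. -/
def unitBallVolume (m : ℕ) : ℝ := volume.real (Metric.closedBall (0 : E m) 1)

/-- `V 0, …, V d` are the coefficients of `K` in the Steiner formula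
`|K ⊕ B(r)| = ∑_{j=0}^d ω_{d-j} V_j r^{d-j}` for all `r ≥ 0`
(and `V j = 0` for `j > d`, which makes `V` unique). -/
def IsSteiner {d : ℕ} (K : Set (E d)) (V : ℕ → ℝ) : Prop :=
  (∀ r : ℝ, 0 ≤ r →
    volume.real (K + Metric.closedBall (0 : E d) r) =
      ∑ j ∈ Finset.range (d + 1), unitBallVolume (d - j) * V j * r ^ (d - j)) ∧
  ∀ j, d < j → V j = 0

theorem unitBallVolume_pos (m : ℕ) : 0 < unitBallVolume m := by
  unfold unitBallVolume
  refine ENNReal.toReal_pos ?_ (isCompact_closedBall _ _).measure_lt_top.ne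
  exact (Metric.measure_closedBall_pos volume _ one_pos).ne'

/-- The Steiner coefficients of a set are uniquely determined. -/
theorem IsSteiner.unique {d : ℕ} {K : Set (E d)} {V W : ℕ → ℝ}
    (hV : IsSteiner K V) (hW : IsSteiner K W) : V = W := by
  let P : (ℕ → ℝ) → Polynomial ℝ := fun U =>
    ∑ j ∈ Finset.range (d + 1), Polynomial.C (unitBallVolume (d - j) * U j) * Polynomial.X ^ (d - j)
  have hP : P V = P W := by
    refine Polynomial.eq_of_infinite_eval_eq _ _ ((Set.Ici_infinite (0 : ℝ)).mono ?_)
    intro r hr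
    simp only [Set.mem_ofPred_eq, P, Polynomial.eval_finsetSum, Polynomial.eval_mul,
      Polynomial.eval_C, Polynomial.eval_pow, Polynomial.eval_X]
    rw [← hV.1 r hr, ← hW.1 r hr]
  have hc : ∀ (U : ℕ → ℝ) (j : ℕ), j ≤ d → (P U).coeff (d - j) = unitBallVolume (d - j) * U j := by
    intro U j hj
    simp only [P, Polynomial.finsetSum_coeff, Polynomial.coeff_C_mul_X_pow]
    rw [Finset.sum_eq_single j]
    · simp
    · intro b hb hbj
      have := Finset.mem_range.1 hb
      rw [if_neg (by omega)]
    · intro h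
      exact absurd (Finset.mem_range.2 (by omega)) h
  funext j
  by_cases hj : j ≤ d
  · have h := hc V j hj
    rw [hP, hc W j hj] at h
    exact (mul_left_cancel₀ (unitBallVolume_pos _).ne' h).symm
  · rw [hV.2 j (by omega), hW.2 j (by omega)]

open Classical in
/-- The `j`-th intrinsic volume, defined through the Steiner formula (which every convex body
satisfies; the value `0` is used only for sets without such a formula). -/
def intrinsicVolume {d : ℕ} (j : ℕ) (K : Set (E d)) : ℝ :=
  if h : ∃ V, IsSteiner K V then h.choose j else 0

theorem IsSteiner.intrinsicVolume_eq {d : ℕ} {K : Set (E d)} {V : ℕ → ℝ}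
    (hV : IsSteiner K V) (j : ℕ) : intrinsicVolume j K = V j := by
  have h : ∃ V, IsSteiner K V := ⟨V, hV⟩
  rw [intrinsicVolume, dif_pos h, h.choose_spec.unique hV]

/-! ### The assumption on the index sets -/

/-- The assumption on the index sets, apart from the surrounding box: `D n` is the set of lattice
points of the `p`-convex set `⋃ i, C n i`, whose volume tends to infinity, and `c n` are positive
scaling vectors with all entries tending to infinity and with product asymptotic to the volume. -/
structure IsScaledIndexSet {d p : ℕ} (D : ℕ → Set (Fin d → ℤ)) (C : ℕ → Fin p → Set (E d))
    (c : ℕ → Fin d → ℝ) : Prop where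
  convexBody : ∀ n i, IsConvexBody (C n i)
  lattice_eq : ∀ n, D n = latticePoints (⋃ i, C n i)
  volume_tendsto : Tendsto (fun n => volume.real (⋃ i, C n i)) atTop atTop
  scale_pos : ∀ n l, 0 < c n l
  scale_tendsto : ∀ l, Tendsto (fun n => c n l) atTop atTop
  prod_equiv : (fun n => ∏ l, c n l) ~[atTop] (fun n => volume.real (⋃ i, C n i))

/-- The surrounding box condition: `C_n ⊆ c_n [-b, b]^d` for all `n`, for some `0 < b < ∞`. -/
def BoxContained {d p : ℕ} (C : ℕ → Fin p → Set (E d)) (c : ℕ → Fin d → ℝ) : Prop :=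
  ∃ b : ℝ, 0 < b ∧ ∀ n, (⋃ i, C n i) ⊆ coordScale (c n) (cube d b)

/-- `∑ i, V_j (c_n⁻¹ C_{n,i})` is bounded in `n` for each `j = 1, …, d - 1`. -/
def IntrinsicVolumesBounded {d p : ℕ} (C : ℕ → Fin p → Set (E d)) (c : ℕ → Fin d → ℝ) : Prop :=
  ∀ j : ℕ, 1 ≤ j → j < d →
    ∃ M : ℝ, ∀ n, |∑ i, intrinsicVolume j (coordScale (fun l => (c n l)⁻¹) (C n i))| ≤ M

/-! ### The approximation by boxes -/

/-- Sequences of positive integers `k_n → ∞` with `k_n^{1/d} = o(c_{n,l})` for every `l`. -/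
structure IsAdmissible {d : ℕ} (c : ℕ → Fin d → ℝ) (k : ℕ → ℕ) : Prop where
  pos : ∀ n, 0 < k n
  tendsto : Tendsto k atTop atTop
  isLittleO : ∀ l, (fun n => (k n : ℝ) ^ (1 / (d : ℝ))) =o[atTop] (fun n => c n l)

/-- The side lengths `⌊c_l / k^{1/d}⌋`. -/
def sideLength {d : ℕ} (c : Fin d → ℝ) (k : ℕ) (l : Fin d) : ℤ :=
  ⌊c l / (k : ℝ) ^ (1 / (d : ℝ))⌋

/-- The box `I_z = ⨉_l [z_l t_l, (z_l + 1) t_l)`. -/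
def gridBox {d : ℕ} (t : Fin d → ℤ) (z : Fin d → ℤ) : Set (E d) :=
  {x | ∀ l, x l ∈ Set.Ico ((z l : ℝ) * (t l : ℝ)) (((z l : ℝ) + 1) * (t l : ℝ))}

/-- The indices of the boxes contained in `A`. -/
def innerIndices {d : ℕ} (t : Fin d → ℤ) (A : Set (E d)) : Set (Fin d → ℤ) :=
  {z | gridBox t z ⊆ A}

/-- The indices of the boxes intersecting `A`. -/
def outerIndices {d : ℕ} (t : Fin d → ℤ) (A : Set (E d)) : Set (Fin d → ℤ) :=
  {z | (gridBox t z ∩ A).Nonempty}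

/-- The outer approximation: the lattice points of all the boxes intersecting `A`. -/
def outerApprox {d : ℕ} (t : Fin d → ℤ) (A : Set (E d)) : Set (Fin d → ℤ) :=
  ⋃ z ∈ outerIndices t A, latticePoints (gridBox t z)

/-- The three approximation properties:
the number of points of `D n` is asymptotic to the volume of `C_n`; for every admissible `k`, the
numbers of boxes inside and meeting `C_n` are both asymptotic to `k_n`; and there is a box
`K_n = ℤ^d ∩ c_n [-b, b]^d`, the same for all admissible `k`, containing the outer approximation
for every `n`. -/
def GoodApproximation {d p : ℕ} (D : ℕ → Set (Fin d → ℤ)) (C : ℕ → Fin p → Set (E d))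
    (c : ℕ → Fin d → ℝ) : Prop :=
  ((fun n => ((D n).ncard : ℝ)) ~[atTop] (fun n => volume.real (⋃ i, C n i))) ∧
  (∀ k : ℕ → ℕ, IsAdmissible c k →
    Tendsto (fun n => ((innerIndices (sideLength (c n) (k n)) (⋃ i, C n i)).ncard : ℝ) / (k n : ℝ))
      atTop (𝓝 1) ∧
    Tendsto (fun n => ((outerIndices (sideLength (c n) (k n)) (⋃ i, C n i)).ncard : ℝ) / (k n : ℝ))
      atTop (𝓝 1)) ∧
  (∃ b : ℝ, 0 < b ∧ ∀ k : ℕ → ℕ, IsAdmissible c k → ∀ n,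
    outerApprox (sideLength (c n) (k n)) (⋃ i, C n i) ⊆
      latticePoints (coordScale (c n) (cube d b)))

end SpatialIndex

end

/-! Counting. A box that meets a convex set `K` without lying in it contains a point that a
hyperplane separates from `K`. In the coordinate direction where the normal varies most over one
box, `d` steps outwards leave `K` (`exists_direction`). So for each direction and sign, a grid line
contains at most `d` such boxes, and boundary boxes are of lower order than all boxes in the
surrounding cube (`ncard_outer_sdiff_inner_le`). Inner and outer box counts bracket the volume
divided by the box volume, so both are asymptotic to it (`tendsto_ncard_mul`). Unit boxes then give
the lattice point count, and admissible boxes give the limits of `p/k` and `q/k`.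

(B) implies (V). The Steiner coefficients are fixed linear combinations of the parallel volumes at
radii `0, …, d`, and inside a cube these are at most the parallel volumes of the cube
(`exists_abs_steiner_le`).

(V) implies (B). After rescaling, `V_0` is at most one and `V_d` is a volume, hence bounded, so the
Steiner formula at radius one bounds the unit parallel volume of the union. A connected set that
contains the origin and reaches far has a large unit parallel volume
(`norm_mul_measureReal_ball_le`), so its reach is bounded.

The Steiner formula. Sweeping a convex body along a segment adds volume linearly in the length, so
the volume of `K` plus a scaled zonotope is polynomial in the scale. Zonotopes approximate the ball,
and limits of polynomials of bounded degree are polynomials. -/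

noncomputable section

namespace SpatialIndex

/-! ### Sweeping a convex set along a segment -/

section Sweep

variable {V : Type*} [NormedAddCommGroup V] [NormedSpace ℝ V]

/-- The set of the multiples `τ v` with `τ ∈ [a, b]`. -/
def multiples (v : V) (a b : ℝ) : Set V := (fun τ : ℝ => τ • v) '' Set.Icc a b

theorem isCompact_multiples (v : V) (a b : ℝ) : IsCompact (multiples v a b) :=
  isCompact_Icc.image (by fun_prop)

theorem convex_multiples (v : V) (a b : ℝ) : Convex ℝ (multiples v a b) :=
  (convex_Icc a b).is_linear_image ⟨fun x y => add_smul x y v, fun c x => by simp [mul_smul]⟩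

theorem multiples_self (v : V) (a : ℝ) : multiples v a a = {a • v} := by
  simp [multiples]

theorem multiples_add_vadd (v : V) (a b s : ℝ) :
    multiples v (a + s) (b + s) = (s • v) +ᵥ multiples v a b := by
  ext x
  simp only [multiples, Set.mem_vadd_set, Set.mem_image, Set.mem_Icc, vadd_eq_add]
  constructor
  · rintro ⟨τ, hτ, rfl⟩
    exact ⟨_, ⟨τ - s, ⟨by linarith, by linarith⟩, rfl⟩, by rw [← add_smul]; congr 1; ring⟩
  · rintro ⟨_, ⟨τ, hτ, rfl⟩, rfl⟩
    exact ⟨τ + s, ⟨by linarith, by linarith⟩, by rw [← add_smul]; congr 1; ring⟩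

theorem add_multiples_mono (K : Set V) (v : V) {a b b' : ℝ} (h : b ≤ b') :
    K + multiples v a b ⊆ K + multiples v a b' :=
  Set.add_subset_add_left (Set.image_mono (Set.Icc_subset_Icc_right h))

theorem subset_add_multiples (K : Set V) (v : V) {t : ℝ} (h : 0 ≤ t) :
    K ⊆ K + multiples v 0 t := by
  have h' := add_multiples_mono K v (a := 0) h
  rwa [multiples_self, zero_smul, Set.add_singleton, Set.image_congr (fun x _ => add_zero x),
    Set.image_id'] at h'

/-- On every line in direction `v`, a convex set grows at its upper end only. -/
theorem sweep_diff_sweep {K : Set V} (hK : Convex ℝ K) (v : V) {s : ℝ} (hs : 0 ≤ s)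
    (t : ℝ) :
    (K + multiples v 0 (s + t)) \ (K + multiples v 0 s) =
      (s • v) +ᵥ ((K + multiples v 0 t) \ K) := by
  ext x
  simp only [multiples, Set.mem_vadd_set, Set.mem_sdiff, Set.mem_add, Set.mem_image, Set.mem_Icc,
    vadd_eq_add]
  constructor
  · rintro ⟨⟨k, hk, _, ⟨τ, ⟨h0, h1⟩, rfl⟩, rfl⟩, hx⟩
    have hτ : s < τ := by
      by_contra! h
      exact hx ⟨k, hk, _, ⟨τ, ⟨h0, h⟩, rfl⟩, rfl⟩
    refine ⟨k + (τ - s) • v, ⟨⟨k, hk, _, ⟨τ - s, ⟨by linarith, by linarith⟩, rfl⟩, rfl⟩, ?_⟩, ?_⟩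
    · intro h
      exact hx ⟨_, h, _, ⟨s, ⟨hs, le_rfl⟩, rfl⟩, by rw [add_assoc, ← add_smul]; congr 2; ring⟩
    · rw [add_left_comm, ← add_smul]; congr 2; ring
  · rintro ⟨_, ⟨⟨k, hk, _, ⟨τ, ⟨h0, h1⟩, rfl⟩, rfl⟩, hy⟩, rfl⟩
    refine ⟨⟨k, hk, _, ⟨s + τ, ⟨by linarith, by linarith⟩, rfl⟩, ?_⟩, ?_⟩
    · rw [add_left_comm, ← add_smul]
    · rintro ⟨k', hk', _, ⟨σ, ⟨g0, g1⟩, rfl⟩, h⟩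
      apply hy
      have hk'' : k' = k + (τ + (s - σ)) • v := by
        rw [eq_sub_of_add_eq h]; module
      have hτ : 0 < τ := by
        rcases h0.eq_or_lt with h | h
        · exact absurd (by simpa [← h] using hk) hy
        · exact h
      have hpos : 0 < τ + (s - σ) := by linarith
      -- The point `k + τ • v` lies on the segment from `k` to `k'`; these weights express it as a
      -- convex combination of the two.
      have := hK hk hk' (a := (s - σ) / (τ + (s - σ))) (b := τ / (τ + (s - σ)))
        (div_nonneg (by linarith) hpos.le) (div_nonneg h0 hpos.le) (by field_simp; ring)
      convert this using 1
      rw [hk'', smul_add, ← add_assoc, ← add_smul, smul_smul]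
      rw [show (s - σ) / (τ + (s - σ)) + τ / (τ + (s - σ)) = 1 by field_simp; ring,
        div_mul_cancel₀ _ hpos.ne', one_smul]

variable [MeasurableSpace V] [BorelSpace V] (μ : Measure V)
  [IsFiniteMeasureOnCompacts μ] [μ.IsAddLeftInvariant]

/-- By `sweep_diff_sweep`, the part added after length `s` is a translate of the part added by a
sweep of length `t`. -/
theorem measureReal_sweep_add {K : Set V} (hK : Convex ℝ K) (hc : IsCompact K) (v : V) {s t : ℝ}
    (hs : 0 ≤ s) (ht : 0 ≤ t) :
    μ.real (K + multiples v 0 (s + t)) - μ.real K =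
      (μ.real (K + multiples v 0 s) - μ.real K) + (μ.real (K + multiples v 0 t) - μ.real K) := by
  have hcomp : ∀ r, IsCompact (K + multiples v 0 r) := fun r =>
    hc.add (isCompact_multiples v 0 r)
  have h1 := measureReal_sdiff (μ := μ) (add_multiples_mono K v (a := 0) (b := s) (b' := s + t)
    (by linarith)) (hcomp s).measurableSet (hcomp _).measure_lt_top.ne
  have h2 := measureReal_sdiff (μ := μ) (subset_add_multiples K v ht) hc.measurableSet
    (hcomp t).measure_lt_top.ne
  have h3 : μ.real ((s • v) +ᵥ ((K + multiples v 0 t) \ K)) =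
      μ.real ((K + multiples v 0 t) \ K) := by
    simp only [Measure.real, measure_vadd]
  rw [sweep_diff_sweep hK v hs t, h3] at h1
  linarith

end Sweep

/-- Monotone additive functions on the half-line are linear. -/
theorem eq_mul_of_additive_of_monotone {h : ℝ → ℝ}
    (hadd : ∀ s t, 0 ≤ s → 0 ≤ t → h (s + t) = h s + h t)
    (hmono : ∀ s t, 0 ≤ s → s ≤ t → h s ≤ h t) {t : ℝ} (ht : 0 ≤ t) : h t = t * h 1 := by
  have h0 : h 0 = 0 := by have := hadd 0 0 le_rfl le_rfl; simp at this; exact this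
  have hn : ∀ (n : ℕ) (s : ℝ), 0 ≤ s → h (n * s) = n * h s := by
    intro n s hs
    induction n with
    | zero => simp [h0]
    | succ n ih =>
      push_cast
      rw [add_mul, one_mul, hadd _ _ (by positivity) hs, ih]; ring
  have h1 : 0 ≤ h 1 := h0 ▸ hmono 0 1 le_rfl zero_le_one
  -- Monotonicity squeezes `n * h t = h (n * t)` between the values at the two neighbouring
  -- integers, so the error is bounded uniformly in `n`.
  have key : ∀ n : ℕ, n * |h t - t * h 1| ≤ h 1 := by
    intro n
    have hnt : 0 ≤ (n : ℝ) * t := by positivity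
    have a1 := hmono _ _ (by positivity) (Nat.floor_le hnt)
    have a2 := hmono _ _ hnt (Nat.lt_floor_add_one ((n : ℝ) * t)).le
    have b := hn ⌊(n : ℝ) * t⌋₊ 1 zero_le_one
    have b' := hn (⌊(n : ℝ) * t⌋₊ + 1) 1 zero_le_one
    push_cast at b'
    rw [mul_one] at b b'
    rw [b, hn n t ht] at a1
    rw [b', hn n t ht] at a2
    have c1 := mul_le_mul_of_nonneg_right (Nat.floor_le hnt) h1
    have c2 := mul_le_mul_of_nonneg_right (Nat.lt_floor_add_one ((n : ℝ) * t)).le h1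
    rw [← Nat.abs_cast n, ← abs_mul, abs_le]
    constructor <;> nlinarith
  have : |h t - t * h 1| ≤ 0 := by
    by_contra! hpos
    obtain ⟨n, hn⟩ := exists_nat_gt (h 1 / |h t - t * h 1|)
    rw [div_lt_iff₀ hpos] at hn
    exact absurd (key n) (not_le.2 hn)
  exact sub_eq_zero.1 (abs_nonpos_iff.1 this)

/-! ### Polynomiality of the volume under addition of a scaled zonotope -/

section Zonotope

variable {V : Type*} [NormedAddCommGroup V] [NormedSpace ℝ V]

/-- The zonotope `∑ v ∈ l, [-r v, r v]`. -/
def zonotope (r : ℝ) : List V → Set V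
  | [] => {0}
  | v :: l => multiples v (-r) r + zonotope r l

theorem isCompact_zonotope (r : ℝ) (l : List V) : IsCompact (zonotope r l) := by
  induction l with
  | nil => exact isCompact_singleton
  | cons v l ih => exact (isCompact_multiples v _ _).add ih

theorem convex_zonotope (r : ℝ) (l : List V) : Convex ℝ (zonotope r l) := by
  induction l with
  | nil => exact convex_singleton 0
  | cons v l ih => exact (convex_multiples v _ _).add ih

variable [MeasurableSpace V] [BorelSpace V] (μ : Measure V)
  [IsFiniteMeasureOnCompacts μ] [μ.IsAddLeftInvariant]

/-- The symmetric segment is a translate of one starting at the origin, for which the gain in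
measure is additive and monotone, hence linear. -/
theorem measureReal_add_multiples {K : Set V} (hK : Convex ℝ K) (hc : IsCompact K) (v : V) {t : ℝ}
    (ht : 0 ≤ t) :
    μ.real (K + multiples v (-t) t) =
      μ.real K + t * (μ.real (K + multiples v (-1) 1) - μ.real K) := by
  have key : ∀ t : ℝ, 0 ≤ t → μ.real (K + multiples v (-t) t) - μ.real K =
      t * (2 * (μ.real (K + multiples v 0 1) - μ.real K)) := by
    intro t ht
    have h1 : multiples v (-t) t = (-t • v) +ᵥ multiples v 0 (2 * t) := by
      rw [← multiples_add_vadd]; congr 1 <;> ring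
    have h2 : K + multiples v (-t) t = (-t • v) +ᵥ (K + multiples v 0 (2 * t)) := by
      rw [h1, ← Set.singleton_vadd, ← Set.singleton_vadd, vadd_eq_add, vadd_eq_add]
      exact add_left_comm _ _ _
    have h3 : μ.real (K + multiples v (-t) t) = μ.real (K + multiples v 0 (2 * t)) := by
      rw [h2]; simp only [Measure.real, measure_vadd]
    rw [h3, eq_mul_of_additive_of_monotone
      (h := fun s => μ.real (K + multiples v 0 s) - μ.real K)
      (fun s t hs ht => measureReal_sweep_add μ hK hc v hs ht)
      (fun s t _ hst => sub_le_sub_right (measureReal_mono (add_multiples_mono K v hst)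
        (hc.add (isCompact_multiples v 0 t)).measure_lt_top.ne) _)
      (show 0 ≤ 2 * t by linarith)]
    ring
  have h1 := key t ht
  have h2 := key 1 zero_le_one
  rw [h2]
  linarith

/-- The measure of `K + r Z`, for a zonotope `Z`, is a polynomial in `r`. -/
theorem exists_polynomial_measureReal_add_zonotope (l : List V) {K : Set V} (hK : Convex ℝ K)
    (hc : IsCompact K) :
    ∃ P : Polynomial ℝ, ∀ r : ℝ, 0 ≤ r → μ.real (K + zonotope r l) = P.eval r := by
  induction l generalizing K with
  | nil => exact ⟨Polynomial.C (μ.real K), fun r _ => by simp [zonotope]⟩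
  | cons v l ih =>
    obtain ⟨P, hP⟩ := ih hK hc
    obtain ⟨Q, hQ⟩ := ih (hK.add (convex_multiples v (-1) 1)) (hc.add (isCompact_multiples v (-1) 1))
    -- With the other summands fixed, the volume is affine in the length of the segment along `v`.
    -- Its values at lengths zero and one are `P` and `Q`, from the induction hypothesis for `K` and
    -- for `K` plus the unit segment.
    refine ⟨P + Polynomial.X * (Q - P), fun r hr => ?_⟩
    have h := measureReal_add_multiples μ (hK.add (convex_zonotope r l))
      (hc.add (isCompact_zonotope r l)) v hr
    have e : ∀ a b, K + zonotope r l + multiples v a b = K + multiples v a b + zonotope r l :=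
      fun a b => add_right_comm _ _ _
    rw [zonotope, ← add_assoc, ← e, h, e, hP r hr, hQ r hr]
    simp

end Zonotope

/-! ### Approximation of the Euclidean ball by zonotopes -/

section Ball

variable {V : Type*} [NormedAddCommGroup V] [InnerProductSpace ℝ V]

/-- With `exists_mem_zonotope_inner_eq`, this computes the support function of a zonotope. -/
theorem inner_le_of_mem_zonotope {r : ℝ} {l : List V} (u : V) {x : V} (hx : x ∈ zonotope r l) :
    inner ℝ u x ≤ r * (l.map fun v => |inner ℝ u v|).sum := by
  induction l generalizing x with
  | nil => rw [zonotope, Set.mem_singleton_iff] at hx; simp [hx]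
  | cons v l ih =>
    obtain ⟨_, ⟨τ, ⟨h0, h1⟩, rfl⟩, y, hy, rfl⟩ := hx
    have := ih hy
    simp only [List.map_cons, List.sum_cons, inner_add_right, inner_smul_right, mul_add]
    have h2 : τ * inner ℝ u v ≤ r * |inner ℝ u v| := by
      calc τ * inner ℝ u v ≤ |τ * inner ℝ u v| := le_abs_self _
        _ = |τ| * |inner ℝ u v| := abs_mul _ _
        _ ≤ _ := mul_le_mul_of_nonneg_right (abs_le.2 ⟨h0, h1⟩) (abs_nonneg _)
    linarith

theorem exists_mem_zonotope_inner_eq {r : ℝ} (hr : 0 ≤ r) (l : List V) (u : V) :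
    ∃ x ∈ zonotope r l, inner ℝ u x = r * (l.map fun v => |inner ℝ u v|).sum := by
  induction l with
  | nil => exact ⟨0, rfl, by simp⟩
  | cons v l ih =>
    obtain ⟨x, hx, hux⟩ := ih
    rcases le_total 0 (inner ℝ u v) with h | h
    · refine ⟨r • v + x, Set.add_mem_add ⟨r, ⟨by linarith, le_rfl⟩, rfl⟩ hx, ?_⟩
      simp [inner_add_right, inner_smul_right, mul_add, hux, abs_of_nonneg h]
    · refine ⟨-r • v + x, Set.add_mem_add ⟨-r, ⟨le_rfl, by linarith⟩, rfl⟩ hx, ?_⟩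
      rw [inner_add_right, inner_smul_right, hux, List.map_cons, List.sum_cons, abs_of_nonpos h]
      ring

theorem zonotope_subset_closedBall {l : List V} {ε r : ℝ} (hε : 0 ≤ ε) (hr : 0 ≤ r)
    (hl : ∀ u : V, |(l.map fun v => |inner ℝ u v|).sum - ‖u‖| ≤ ε * ‖u‖) :
    zonotope r l ⊆ Metric.closedBall 0 ((1 + ε) * r) := by
  intro x hx
  rw [mem_closedBall_zero_iff]
  have h1 := inner_le_of_mem_zonotope x hx
  rw [real_inner_self_eq_norm_sq] at h1
  have h2 := (abs_le.1 (hl x)).2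
  rcases (norm_nonneg x).eq_or_lt with h | h
  · rw [← h]; positivity
  · have : r * (l.map fun v => |inner ℝ x v|).sum ≤ r * ((1 + ε) * ‖x‖) :=
      mul_le_mul_of_nonneg_left (by linarith) hr
    have h5 : ‖x‖ * ‖x‖ ≤ ((1 + ε) * r) * ‖x‖ := by nlinarith
    exact le_of_mul_le_mul_right h5 h

/-- A point outside the zonotope is separated from it by a hyperplane with some normal `a`. In
direction `a` the support function of the zonotope is at least that of the smaller ball. -/
theorem closedBall_subset_zonotope {l : List V} {ε r : ℝ} (hr : 0 ≤ r)
    (hl : ∀ u : V, |(l.map fun v => |inner ℝ u v|).sum - ‖u‖| ≤ ε * ‖u‖) [CompleteSpace V] :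
    Metric.closedBall 0 ((1 - ε) * r) ⊆ zonotope r l := by
  intro y hy
  by_contra hyZ
  obtain ⟨f, s, hs, hsy⟩ := geometric_hahn_banach_closed_point (convex_zonotope r l)
    (isCompact_zonotope r l).isClosed hyZ
  set a := (InnerProductSpace.toDual ℝ V).symm f with ha
  have hf : ∀ x, f x = inner ℝ a x := fun x => by
    rw [ha, InnerProductSpace.toDual_symm_apply]
  obtain ⟨x, hx, hax⟩ := exists_mem_zonotope_inner_eq hr l a
  have h1 := hs x hx
  rw [hf, hax] at h1
  rw [hf] at hsy
  rw [mem_closedBall_zero_iff] at hy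
  have h2 := (abs_le.1 (hl a)).1
  have h3 := real_inner_le_norm a y
  have h4 : ‖a‖ * ‖y‖ ≤ ‖a‖ * ((1 - ε) * r) := mul_le_mul_of_nonneg_left hy (norm_nonneg _)
  have h5 : r * ((1 - ε) * ‖a‖) ≤ r * (l.map fun v => |inner ℝ a v|).sum :=
    mul_le_mul_of_nonneg_left (by linarith) hr
  nlinarith

variable [FiniteDimensional ℝ V] [MeasurableSpace V] [BorelSpace V]

/-- The reflection that takes `u` to `w` preserves the ball and the measure. -/
theorem setIntegral_abs_inner_eq_of_norm_eq {u w : V} (h : ‖u‖ = ‖w‖) :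
    ∫ v in Metric.closedBall (0 : V) 1, |inner ℝ u v| =
      ∫ v in Metric.closedBall (0 : V) 1, |inner ℝ w v| := by
  set ρ := (ℝ ∙ (u - w))ᗮ.reflection with hρ
  have huw : ρ u = w := Submodule.reflection_sub h
  have h1 := ρ.measurePreserving.setIntegral_preimage_emb
    ρ.toHomeomorph.measurableEmbedding (fun v => |inner ℝ w v|) (Metric.closedBall (0 : V) 1)
  have h2 : ρ ⁻¹' Metric.closedBall (0 : V) 1 = Metric.closedBall (0 : V) 1 := by
    ext x; simp
  rw [h2] at h1
  rw [← h1]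
  refine integral_congr_ae (ae_of_all _ fun v => ?_)
  simp only
  rw [← huw, LinearIsometryEquiv.inner_map_map]

theorem exists_setAverage_abs_inner_eq [Nontrivial V] :
    ∃ κ : ℝ, 0 < κ ∧ ∀ u : V, ⨍ v in Metric.closedBall (0 : V) 1, |inner ℝ u v| = κ * ‖u‖ := by
  obtain ⟨e, he⟩ := exists_norm_eq V zero_le_one
  have hB : 0 < volume.real (Metric.closedBall (0 : V) 1) :=
    ENNReal.toReal_pos (Metric.measure_closedBall_pos volume _ one_pos).ne'
      (isCompact_closedBall _ _).measure_lt_top.ne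
  have hpos : 0 < ∫ v in Metric.closedBall (0 : V) 1, |inner ℝ e v| := by
    have hcont : Continuous fun v : V => |inner ℝ e v| := by fun_prop
    rw [setIntegral_pos_iff_support_of_nonneg_ae (ae_of_all _ fun v => abs_nonneg _)
      (hcont.continuousOn.integrableOn_compact (isCompact_closedBall _ _))]
    have hopen : IsOpen ((Function.support fun v : V => |inner ℝ e v|) ∩ Metric.ball 0 1) :=
      hcont.isOpen_support.inter Metric.isOpen_ball
    refine (hopen.measure_pos volume ⟨(1 / 2 : ℝ) • e, ?_, ?_⟩).trans_le
      (measure_mono (Set.inter_subset_inter_right _ Metric.ball_subset_closedBall))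
    · simp [inner_smul_right, he]
    · simp [norm_smul, he]; norm_num
  refine ⟨(volume.real (Metric.closedBall (0 : V) 1))⁻¹ *
    ∫ v in Metric.closedBall (0 : V) 1, |inner ℝ e v|, by positivity, fun u => ?_⟩
  rw [setAverage_eq, setIntegral_abs_inner_eq_of_norm_eq (u := u) (w := ‖u‖ • e)
    (by simp [norm_smul, he])]
  simp only [inner_smul_left, abs_mul, smul_eq_mul]
  rw [integral_const_mul]
  simp
  ring

/-- The Euclidean norm is a uniform limit of support functions of zonotopes. -/
theorem exists_list_abs_sum_inner_sub_norm_le [Nontrivial V] {ε : ℝ} (hε : 0 < ε) :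
    ∃ l : List V, ∀ u : V, |(l.map fun v => |inner ℝ u v|).sum - ‖u‖| ≤ ε * ‖u‖ := by
  obtain ⟨κ, hκ, hav⟩ := exists_setAverage_abs_inner_eq (V := V)
  -- `F v` is the support function of one segment. The factor `κ⁻¹` makes the average of `F` over
  -- the unit ball equal to the norm.
  let F : C(V, C(Metric.closedBall (0 : V) 1, ℝ)) :=
    ContinuousMap.curry ⟨fun q => |inner ℝ (q.2 : V) (κ⁻¹ • q.1)|, by fun_prop⟩
  let S : Set C(Metric.closedBall (0 : V) 1, ℝ) :=
    {g | ∃ l : List V, ∀ u, g u = (l.map fun v => |inner ℝ (u : V) v|).sum}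
  have hscale : ∀ (a : ℝ), 0 ≤ a → ∀ (l : List V) (u : V),
      ((l.map (a • ·)).map fun v => |inner ℝ u v|).sum = a * (l.map fun v => |inner ℝ u v|).sum := by
    intro a ha l u
    rw [List.map_map, ← List.sum_map_mul_left]
    congr 1
    refine List.map_congr_left fun v _ => ?_
    simp [inner_smul_right, abs_mul, abs_of_nonneg ha]
  have hS : Convex ℝ S := by
    rintro g ⟨l, hl⟩ g' ⟨l', hl'⟩ a b ha hb -
    refine ⟨l.map (a • ·) ++ l'.map (b • ·), fun u => ?_⟩
    rw [List.map_append, List.sum_append, hscale a ha, hscale b hb]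
    simp [hl, hl']
  have hFS : ∀ v, F v ∈ S := fun v => ⟨[κ⁻¹ • v], fun u => by simp [F]⟩
  have hint : IntegrableOn F (Metric.closedBall (0 : V) 1) volume :=
    F.continuous.continuousOn.integrableOn_compact (isCompact_closedBall _ _)
  -- An average of elements of a closed convex set stays in it, so the norm is a limit, uniformly on
  -- the ball, of support functions of zonotopes.
  have hmem := hS.closure.set_average_mem isClosed_closure
    (Metric.measure_closedBall_pos volume (0 : V) one_pos).ne'
    (isCompact_closedBall _ _).measure_lt_top.ne
    (ae_of_all _ fun v => subset_closure (hFS v)) hint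
  obtain ⟨g, ⟨l, hl⟩, hg⟩ := Metric.mem_closure_iff.1 hmem ε hε
  have heval : ∀ u : Metric.closedBall (0 : V) 1,
      (⨍ v in Metric.closedBall (0 : V) 1, F v) u = ‖(u : V)‖ := by
    intro u
    have h1 := (ContinuousMap.evalCLM ℝ u).integral_comp_comm hint
    have h2 := hav (κ⁻¹ • (u : V))
    rw [norm_smul, norm_inv, Real.norm_of_nonneg hκ.le, mul_inv_cancel_left₀ hκ.ne',
      setAverage_eq] at h2
    rw [setAverage_eq, ContinuousMap.smul_apply]
    change _ • (ContinuousMap.evalCLM ℝ u) _ = _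
    rw [← h1, ← h2]
    congr 2
    ext v
    simp [F, inner_smul_left, inner_smul_right]
  have hball : ∀ u : V, ‖u‖ ≤ 1 → |(l.map fun v => |inner ℝ u v|).sum - ‖u‖| ≤ ε := by
    intro u hu
    have hu' : u ∈ Metric.closedBall (0 : V) 1 := by simpa using hu
    have := (ContinuousMap.dist_apply_le_dist (f := g)
      (g := ⨍ v in Metric.closedBall (0 : V) 1, F v) ⟨u, hu'⟩).trans
      ((dist_comm _ _).trans_le hg.le)
    rwa [heval, hl, Real.dist_eq] at this
  refine ⟨l, fun u => ?_⟩
  rcases eq_or_ne u 0 with rfl | hu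
  · simp
  have hu0 : 0 < ‖u‖ := norm_pos_iff.2 hu
  have h1 := hball (‖u‖⁻¹ • u) (by rw [norm_smul, norm_inv, norm_norm, inv_mul_cancel₀ hu0.ne'])
  have h2 : (l.map fun v => |inner ℝ (‖u‖⁻¹ • u) v|).sum =
      ‖u‖⁻¹ * (l.map fun v => |inner ℝ u v|).sum := by
    rw [← List.sum_map_mul_left]
    congr 1
    refine List.map_congr_left fun v _ => ?_
    simp [inner_smul_left, abs_mul]
  rw [h2, norm_smul, norm_inv, norm_norm, ← mul_sub, abs_mul, abs_inv, abs_norm,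
    inv_mul_le_iff₀ hu0] at h1
  linarith

end Ball

/-! ### The Steiner formula for compact convex sets -/

open Polynomial in
-- If `Q` had smaller degree, `P = O(Q)` and `Q = o(P)` would give `P = o(P)`, impossible for a
-- nonzero polynomial.
theorem degree_le_of_eventually_abs_eval_le {P Q : ℝ[X]}
    (h : ∀ᶠ r in atTop, |P.eval r| ≤ |Q.eval r|) : P.degree ≤ Q.degree := by
  by_contra! hlt
  have h1 : P.eval =O[atTop] Q.eval := IsBigO.of_bound 1 (by simpa using h)
  have h2 := h1.trans_isLittleO (Polynomial.isLittleO_atTop_of_degree_lt _ _ hlt)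
  have hP : P ≠ 0 := by rintro rfl; simp at hlt
  exact isLittleO_irrefl (P.eventually_atTop_not_isRoot hP).frequently h2

/-- The `i`-th Lagrange basis polynomial for the nodes `0, …, d`. -/
def lagrangeBasis (d i : ℕ) : Polynomial ℝ :=
  Lagrange.basis (Finset.range (d + 1)) (fun j : ℕ => (j : ℝ)) i

theorem eq_sum_eval_mul_lagrangeBasis {d : ℕ} {P : Polynomial ℝ} (hP : P.degree ≤ d) :
    P = ∑ i ∈ Finset.range (d + 1), Polynomial.C (P.eval (i : ℝ)) * lagrangeBasis d i := by
  have hlt : P.degree < (Finset.range (d + 1)).card := by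
    rw [Finset.card_range]
    exact hP.trans_lt (by exact_mod_cast Nat.lt_succ_self d)
  have := Lagrange.eq_interpolate (s := Finset.range (d + 1)) (v := fun j : ℕ => (j : ℝ))
    (Nat.cast_injective.injOn) hlt
  rw [Lagrange.interpolate_apply] at this
  exact this

theorem degree_lagrangeBasis_le {d i : ℕ} (hi : i ∈ Finset.range (d + 1)) :
    (lagrangeBasis d i).degree ≤ d := by
  rw [lagrangeBasis, Lagrange.degree_basis Nat.cast_injective.injOn hi]
  simp

/-- Pointwise limits of polynomials of degree at most `d` on the half-line are polynomials of degree
at most `d`. -/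
theorem exists_polynomial_of_tendsto_eval {d : ℕ} {P : ℕ → Polynomial ℝ} {F : ℝ → ℝ}
    (hP : ∀ n, (P n).degree ≤ d)
    (hF : ∀ r : ℝ, 0 ≤ r → Tendsto (fun n => (P n).eval r) atTop (𝓝 (F r))) :
    ∃ Q : Polynomial ℝ, Q.degree ≤ d ∧ ∀ r : ℝ, 0 ≤ r → F r = Q.eval r := by
  refine ⟨∑ i ∈ Finset.range (d + 1), Polynomial.C (F i) * lagrangeBasis d i, ?_, fun r hr => ?_⟩
  · refine (Polynomial.degree_sum_le _ _).trans (Finset.sup_le fun i hi => ?_)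
    refine (Polynomial.degree_mul_le _ _).trans ?_
    simpa using add_le_add Polynomial.degree_C_le (degree_lagrangeBasis_le hi)
  · refine tendsto_nhds_unique (hF r hr) ?_
    have h : (fun n => (P n).eval r) = fun n => ∑ i ∈ Finset.range (d + 1),
        (P n).eval (i : ℝ) * (lagrangeBasis d i).eval r := by
      funext n
      conv_lhs => rw [eq_sum_eval_mul_lagrangeBasis (hP n)]
      simp [Polynomial.eval_finsetSum]
    rw [h, Polynomial.eval_finsetSum]
    simp only [Polynomial.eval_mul, Polynomial.eval_C]
    exact tendsto_finsetSum _ fun i _ => (hF i (Nat.cast_nonneg i)).mul_const _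

section Steiner

variable {V : Type*} [NormedAddCommGroup V] [InnerProductSpace ℝ V]

/-- Since `K` contains the origin, it lies in `s • K`. A relative error in the radius thus costs
only a factor `s ^ d` in volume. -/
theorem add_closedBall_subset_smul {K : Set V} (hK : Convex ℝ K) (h0 : (0 : V) ∈ K) {s : ℝ}
    (hs : 1 ≤ s) (r : ℝ) :
    K + Metric.closedBall (0 : V) (s * r) ⊆ s • (K + Metric.closedBall (0 : V) r) := by
  have hs0 : 0 < s := by linarith
  rw [smul_add]
  refine Set.add_subset_add (fun x hx => ?_) ?_
  · rw [Set.mem_smul_set_iff_inv_smul_mem₀ hs0.ne']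
    exact hK.smul_mem_of_zero_mem h0 hx ⟨by positivity, inv_le_one_of_one_le₀ hs⟩
  · rw [_root_.smul_closedBall' hs0.ne', Real.norm_of_nonneg hs0.le, smul_zero]

theorem smul_subset_add_closedBall {K : Set V} (hK : Convex ℝ K) (h0 : (0 : V) ∈ K) {s : ℝ}
    (hs0 : 0 < s) (hs : s ≤ 1) (r : ℝ) :
    s • (K + Metric.closedBall (0 : V) r) ⊆ K + Metric.closedBall (0 : V) (s * r) := by
  rw [smul_add]
  refine Set.add_subset_add ?_ ?_
  · rintro _ ⟨x, hx, rfl⟩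
    exact hK.smul_mem_of_zero_mem h0 hx ⟨hs0.le, hs⟩
  · rw [_root_.smul_closedBall' hs0.ne', Real.norm_of_nonneg hs0.le, smul_zero]

variable [FiniteDimensional ℝ V] [MeasurableSpace V] [BorelSpace V]

theorem measureReal_smul_of_nonneg {s : ℝ} (hs : 0 ≤ s) (A : Set V) :
    volume.real (s • A) = s ^ Module.finrank ℝ V * volume.real A := by
  rw [Measure.real, Measure.addHaar_smul, ENNReal.toReal_mul, ENNReal.toReal_ofReal (abs_nonneg _),
    abs_of_nonneg (by positivity), Measure.real]

theorem exists_polynomial_measureReal_add_closedBall_of_zero_mem [Nontrivial V] {K : Set V}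
    (hK : Convex ℝ K) (hc : IsCompact K) (h0 : (0 : V) ∈ K) :
    ∃ Q : Polynomial ℝ, Q.degree ≤ Module.finrank ℝ V ∧ ∀ r : ℝ, 0 ≤ r →
      volume.real (K + Metric.closedBall (0 : V) r) = Q.eval r := by
  set d := Module.finrank ℝ V with hd
  let ε : ℕ → ℝ := fun n => 1 / ((n : ℝ) + 2)
  have hε0 : ∀ n, 0 < ε n := fun n => by positivity
  have hε1 : ∀ n, ε n < 1 := fun n => by
    simp only [ε]; rw [div_lt_one (by positivity)]; linarith [n.cast_nonneg (α := ℝ)]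
  have hεlim : Tendsto ε atTop (𝓝 0) := by
    refine Tendsto.div_atTop tendsto_const_nhds
      (tendsto_atTop_add_const_right _ _ tendsto_natCast_atTop_atTop)
  choose l hl using fun n => exists_list_abs_sum_inner_sub_norm_le (V := V) (hε0 n)
  choose P hP using fun n =>
    exists_polynomial_measureReal_add_zonotope (volume : Measure V) (l n) hK hc
  have hfin : ∀ r, volume (K + Metric.closedBall (0 : V) r) ≠ ⊤ := fun r =>
    (hc.add (isCompact_closedBall _ _)).measure_lt_top.ne
  have hZfin : ∀ n r, volume (K + zonotope r (l n)) ≠ ⊤ := fun n r =>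
    (hc.add (isCompact_zonotope _ _)).measure_lt_top.ne
  have hup : ∀ n r, 0 ≤ r → (P n).eval r ≤
      (1 + ε n) ^ d * volume.real (K + Metric.closedBall (0 : V) r) := by
    intro n r hr
    have h1 := (hε0 n).le
    rw [← hP n r hr, ← measureReal_smul_of_nonneg (by linarith)]
    refine measureReal_mono ((Set.add_subset_add_left (zonotope_subset_closedBall h1 hr (hl n))).trans
      (add_closedBall_subset_smul hK h0 (by linarith) r)) ?_
    rw [Measure.addHaar_smul]
    exact ENNReal.mul_ne_top ENNReal.ofReal_ne_top (hfin r)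
  have hlow : ∀ n r, 0 ≤ r →
      (1 - ε n) ^ d * volume.real (K + Metric.closedBall (0 : V) r) ≤ (P n).eval r := by
    intro n r hr
    have h1 := (hε0 n).le
    have h2 := hε1 n
    rw [← hP n r hr, ← measureReal_smul_of_nonneg (by linarith)]
    exact measureReal_mono ((smul_subset_add_closedBall hK h0 (by linarith) (by linarith) r).trans
      (Set.add_subset_add_left (closedBall_subset_zonotope hr (hl n)))) (hZfin n r)
  obtain ⟨R, hR⟩ := hc.isBounded.subset_closedBall (0 : V)
  refine exists_polynomial_of_tendsto_eval (P := P) (fun n => ?_) fun r hr => ?_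
  -- `K` lies in a ball of radius `|R|`, so `P n` is dominated by a multiple of the volume of a ball
  -- of radius `|R| + r`. This bounds its degree by `d`, independently of the number of segments in
  -- the zonotope.
  · let Q : Polynomial ℝ := Polynomial.C ((1 + ε n) ^ d * volume.real (Metric.closedBall (0 : V) 1)) *
      (Polynomial.C |R| + Polynomial.X) ^ d
    have hQ : Q.degree ≤ d := by
      refine (Polynomial.degree_mul_le _ _).trans ?_
      have h1 : ((Polynomial.C |R| + Polynomial.X : Polynomial ℝ) ^ d).degree ≤ d := by
        refine (Polynomial.degree_pow_le _ _).trans ?_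
        rw [add_comm, Polynomial.degree_X_add_C]
        simp
      exact (add_le_add Polynomial.degree_C_le h1).trans_eq (zero_add _)
    refine (degree_le_of_eventually_abs_eval_le ?_).trans hQ
    filter_upwards [eventually_ge_atTop 0] with r hr
    rw [← hP n r hr, abs_of_nonneg measureReal_nonneg, hP n r hr]
    refine ((hup n r hr).trans ?_).trans (le_abs_self _)
    simp only [Q, Polynomial.eval_mul, Polynomial.eval_C, Polynomial.eval_pow, Polynomial.eval_add,
      Polynomial.eval_X, mul_assoc]
    refine mul_le_mul_of_nonneg_left ?_ (by have := hε0 n; positivity)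
    rw [mul_comm, ← measureReal_smul_of_nonneg (by positivity)]
    refine measureReal_mono ?_ ?_
    · rw [_root_.smul_closedBall _ _ zero_le_one, smul_zero, mul_one, Real.norm_of_nonneg (by positivity)]
      rintro _ ⟨x, hx, y, hy, rfl⟩
      have hx' := mem_closedBall_zero_iff.1 (hR hx)
      rw [mem_closedBall_zero_iff] at hy ⊢
      exact (norm_add_le _ _).trans (add_le_add (hx'.trans (le_abs_self R)) hy)
    · exact ((isCompact_closedBall _ _).smul _).measure_lt_top.ne
  · refine tendsto_of_tendsto_of_tendsto_of_le_of_le (g := fun n => (1 - ε n) ^ d *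
      volume.real (K + Metric.closedBall (0 : V) r)) (h := fun n => (1 + ε n) ^ d *
      volume.real (K + Metric.closedBall (0 : V) r)) ?_ ?_ (fun n => hlow n r hr)
      (fun n => hup n r hr)
    · simpa using (((tendsto_const_nhds (x := (1 : ℝ))).sub hεlim).pow d).mul_const
        (volume.real (K + Metric.closedBall (0 : V) r))
    · simpa using (((tendsto_const_nhds (x := (1 : ℝ))).add hεlim).pow d).mul_const
        (volume.real (K + Metric.closedBall (0 : V) r))

/-- The Steiner formula: the volume of the outer parallel sets of a compact convex set is a
polynomial in the distance. -/
theorem exists_polynomial_measureReal_add_closedBall [Nontrivial V] {K : Set V}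
    (hK : Convex ℝ K) (hc : IsCompact K) (hne : K.Nonempty) :
    ∃ Q : Polynomial ℝ, Q.degree ≤ Module.finrank ℝ V ∧ ∀ r : ℝ, 0 ≤ r →
      volume.real (K + Metric.closedBall (0 : V) r) = Q.eval r := by
  obtain ⟨x, hx⟩ := hne
  obtain ⟨Q, hQ, hQr⟩ := exists_polynomial_measureReal_add_closedBall_of_zero_mem
    (hK.vadd (-x)) (hc.vadd (-x)) ⟨x, hx, by simp⟩
  refine ⟨Q, hQ, fun r hr => ?_⟩
  have hx' : (-x +ᵥ K) + Metric.closedBall (0 : V) r = -x +ᵥ (K + Metric.closedBall (0 : V) r) := by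
    simp only [← Set.singleton_vadd, vadd_eq_add, add_assoc]
  rw [← hQr r hr, hx']
  simp only [Measure.real, measure_vadd]

end Steiner

theorem exists_isSteiner {d : ℕ} (hd : d ≠ 0) {K : Set (E d)} (hK : Convex ℝ K)
    (hc : IsCompact K) (hne : K.Nonempty) : ∃ V, IsSteiner K V := by
  have : Nonempty (Fin d) := ⟨⟨0, Nat.pos_of_ne_zero hd⟩⟩
  obtain ⟨Q, hQ, hQr⟩ := exists_polynomial_measureReal_add_closedBall hK hc hne
  rw [finrank_euclideanSpace_fin] at hQ
  refine ⟨fun j => if j ≤ d then Q.coeff (d - j) / unitBallVolume (d - j) else 0, fun r hr => ?_,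
    fun j hj => if_neg (not_le.2 hj)⟩
  rw [hQr r hr, Polynomial.eval_eq_sum_range' (n := d + 1)
    (Nat.lt_succ_of_le (Polynomial.natDegree_le_of_degree_le hQ)), ← Finset.sum_range_reflect]
  refine Finset.sum_congr rfl fun j hj => ?_
  have hj' : j ≤ d := Nat.lt_succ_iff.1 (Finset.mem_range.1 hj)
  simp only [if_pos hj']
  rw [mul_div_cancel₀ _ (unitBallVolume_pos _).ne']
  simp

/-! ### Coordinate-wise scaling -/

section Scaling

variable {d : ℕ}

theorem mem_coordScale_iff {r : Fin d → ℝ} (hr : ∀ l, r l ≠ 0) {A : Set (E d)} {x : E d} :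
    x ∈ coordScale r A ↔ (WithLp.toLp 2 (fun l => (r l)⁻¹ * x l) : E d) ∈ A := by
  constructor
  · rintro ⟨a, ha, rfl⟩
    convert ha using 1
    ext l
    simp [hr l]
  · intro h
    refine ⟨_, h, ?_⟩
    ext l
    simp [hr l]

theorem coordScale_eq_image (r : Fin d → ℝ) (A : Set (E d)) :
    coordScale r A = Matrix.toEuclideanLin (Matrix.diagonal r) '' A := by
  refine Set.image_congr fun a _ => ?_
  ext l
  simp [Matrix.toEuclideanLin, Matrix.mulVec_diagonal]

theorem measureReal_coordScale {r : Fin d → ℝ} (hr : ∀ l, 0 < r l) (A : Set (E d)) :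
    volume.real (coordScale r A) = (∏ l, r l) * volume.real A := by
  have hdet : LinearMap.det (Matrix.toEuclideanLin (Matrix.diagonal r)) = ∏ l, r l := by
    rw [Matrix.toEuclideanLin, Matrix.toLpLin_eq_toLin, LinearMap.det_toLin, Matrix.det_diagonal]
  have hpos : 0 ≤ ∏ l, r l := Finset.prod_nonneg fun l _ => (hr l).le
  rw [coordScale_eq_image, Measure.real, Measure.addHaar_image_linearMap, hdet, ENNReal.toReal_mul,
    ENNReal.toReal_ofReal (abs_nonneg _), abs_of_nonneg hpos, Measure.real]

theorem continuous_coordScale (r : Fin d → ℝ) :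
    Continuous fun a : E d => (WithLp.toLp 2 (fun l => r l * a l) : E d) := by
  fun_prop

theorem isConnected_coordScale {A : Set (E d)} (hA : IsConnected A) (r : Fin d → ℝ) :
    IsConnected (coordScale r A) :=
  hA.image _ (continuous_coordScale r).continuousOn

theorem convex_coordScale {A : Set (E d)} (hA : Convex ℝ A) (r : Fin d → ℝ) :
    Convex ℝ (coordScale r A) := by
  rw [coordScale_eq_image]
  exact hA.linear_image _

theorem isCompact_coordScale {A : Set (E d)} (hA : IsCompact A) (r : Fin d → ℝ) :
    IsCompact (coordScale r A) :=
  hA.image (continuous_coordScale r)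

theorem coordScale_iUnion {ι : Type*} (r : Fin d → ℝ) (A : ι → Set (E d)) :
    coordScale r (⋃ i, A i) = ⋃ i, coordScale r (A i) :=
  Set.image_iUnion

theorem subset_coordScale_iff {r : Fin d → ℝ} (hr : ∀ l, 0 < r l) {A B : Set (E d)} :
    A ⊆ coordScale r B ↔ coordScale (fun l => (r l)⁻¹) A ⊆ B := by
  rw [coordScale.eq_1 _ A, Set.image_subset_iff]
  exact ⟨fun h x hx => (mem_coordScale_iff fun l => (hr l).ne').1 (h hx),
    fun h x hx => (mem_coordScale_iff fun l => (hr l).ne').2 (h hx)⟩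

theorem isCompact_cube (d : ℕ) (b : ℝ) : IsCompact (cube d b) := by
  have h : cube d b = (EuclideanSpace.equiv (Fin d) ℝ).toHomeomorph ⁻¹'
      (Set.univ.pi fun _ => Set.Icc (-b) b) := by
    ext x
    simp only [cube, Set.mem_preimage, Set.mem_pi, Set.mem_univ, true_imp_iff]
    rfl
  rw [h, Homeomorph.isCompact_preimage]
  exact isCompact_univ_pi fun _ => isCompact_Icc

theorem closedBall_subset_cube (d : ℕ) (b : ℝ) : Metric.closedBall (0 : E d) b ⊆ cube d b := by
  intro x hx l
  rw [mem_closedBall_zero_iff] at hx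
  exact abs_le.1 ((PiLp.norm_apply_le x l).trans hx)

end Scaling

/-! ### Bounds for the Steiner coefficients -/

section Coefficients

variable {d : ℕ}

/-- The Steiner coefficients of the compact sets in a cube are uniformly bounded. -/
theorem exists_abs_steiner_le (d : ℕ) (b : ℝ) (j : ℕ) :
    ∃ M : ℝ, ∀ (K : Set (E d)) (V : ℕ → ℝ), K ⊆ cube d b → IsSteiner K V → |V j| ≤ M := by
  -- The interpolation nodes are `0, …, d`, so the parallel body of the cube at the largest radius
  -- `d` bounds every sampled volume.
  let S : ℝ := volume.real (cube d b + Metric.closedBall (0 : E d) d)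
  refine ⟨(unitBallVolume (d - j))⁻¹ *
    ∑ i ∈ Finset.range (d + 1), S * |(lagrangeBasis d i).coeff (d - j)|, fun K V hK hV => ?_⟩
  have hS : 0 ≤ S := measureReal_nonneg
  by_cases hj : d < j
  · rw [hV.2 j hj, abs_zero]
    exact mul_nonneg (inv_nonneg.2 (unitBallVolume_pos _).le)
      (Finset.sum_nonneg fun i _ => mul_nonneg hS (abs_nonneg _))
  let P : Polynomial ℝ := ∑ j ∈ Finset.range (d + 1),
    Polynomial.C (unitBallVolume (d - j) * V j) * Polynomial.X ^ (d - j)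
  have hdeg : P.degree ≤ d := by
    refine (Polynomial.degree_sum_le _ _).trans (Finset.sup_le fun i hi => ?_)
    refine (Polynomial.degree_C_mul_X_pow_le _ _).trans ?_
    exact_mod_cast Nat.sub_le d i
  have heval : ∀ r : ℝ, 0 ≤ r → P.eval r = volume.real (K + Metric.closedBall (0 : E d) r) := by
    intro r hr
    rw [hV.1 r hr]
    simp [P, Polynomial.eval_finsetSum]
  have hcoeff : P.coeff (d - j) = unitBallVolume (d - j) * V j := by
    simp only [P, Polynomial.finsetSum_coeff, Polynomial.coeff_C_mul_X_pow]
    rw [Finset.sum_eq_single j]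
    · simp
    · intro i hi hij
      have := Finset.mem_range.1 hi
      rw [if_neg (by omega)]
    · intro h
      exact absurd (Finset.mem_range.2 (by omega)) h
  rw [eq_sum_eval_mul_lagrangeBasis hdeg] at hcoeff
  simp only [Polynomial.finsetSum_coeff, Polynomial.coeff_C_mul] at hcoeff
  rw [le_inv_mul_iff₀ (unitBallVolume_pos _), ← abs_of_pos (unitBallVolume_pos (d - j)), ← abs_mul,
    ← hcoeff]
  refine (Finset.abs_sum_le_sum_abs _ _).trans (Finset.sum_le_sum fun i hi => ?_)
  rw [abs_mul, heval i (Nat.cast_nonneg i), abs_of_nonneg measureReal_nonneg]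
  refine mul_le_mul_of_nonneg_right (measureReal_mono (Set.add_subset_add hK
    (Metric.closedBall_subset_closedBall ?_)) ?_) (abs_nonneg _)
  · exact_mod_cast Nat.lt_succ_iff.1 (Finset.mem_range.1 hi)
  · exact ((isCompact_cube d b).add (isCompact_closedBall _ _)).measure_lt_top.ne

theorem unitBallVolume_zero : unitBallVolume 0 = 1 := by
  have h := (EuclideanSpace.volume_preserving_symm_measurableEquiv_toLp (Fin 0)).measure_preimage
    (s := Set.univ) MeasurableSet.univ.nullMeasurableSet
  have hB : Metric.closedBall (0 : E 0) 1 = Set.univ :=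
    Set.eq_univ_of_forall fun x => by simp [Subsingleton.elim x 0]
  rw [unitBallVolume, hB, Measure.real, ← Set.preimage_univ, h, volume_pi, Measure.pi_of_empty]
  simp

theorem IsSteiner.apply_dim {K : Set (E d)} {V : ℕ → ℝ} (hV : IsSteiner K V) :
    V d = volume.real K := by
  have h := hV.1 0 le_rfl
  rw [Metric.closedBall_zero, Set.singleton_zero, add_zero, Finset.sum_range_succ,
    Finset.sum_eq_zero] at h
  · simp [unitBallVolume_zero] at h
    exact h.symm
  · intro j hj
    rw [zero_pow (by have := Finset.mem_range.1 hj; omega), mul_zero]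

theorem measureReal_closedBall_eq {r : ℝ} (hr : 0 ≤ r) :
    volume.real (Metric.closedBall (0 : E d) r) = r ^ d * unitBallVolume d := by
  have h := measureReal_smul_of_nonneg hr (Metric.closedBall (0 : E d) 1)
  rwa [_root_.smul_closedBall _ _ zero_le_one, smul_zero, mul_one, Real.norm_of_nonneg hr,
    finrank_euclideanSpace_fin] at h

/-- Divide the Steiner formula by `r ^ d` and let `r → ∞`, comparing with the ball of radius `|R| +
r`. -/
theorem IsSteiner.apply_zero_le_one {K : Set (E d)} {V : ℕ → ℝ} (hV : IsSteiner K V)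
    (hK : Bornology.IsBounded K) : V 0 ≤ 1 := by
  obtain ⟨R, hR⟩ := hK.subset_closedBall (0 : E d)
  have hinv : Tendsto (fun r : ℝ => r⁻¹) atTop (𝓝 0) := tendsto_inv_atTop_zero
  have h1 : Tendsto (fun r : ℝ => ∑ j ∈ Finset.range (d + 1),
      unitBallVolume (d - j) * V j * (r⁻¹) ^ j) atTop (𝓝 (unitBallVolume d * V 0)) := by
    have h := tendsto_finsetSum (Finset.range (d + 1)) fun j _ =>
      (hinv.pow j).const_mul (unitBallVolume (d - j) * V j)
    rw [Finset.sum_eq_single 0 (fun j _ hj => by simp [hj]) (by simp)] at h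
    simpa using h
  have h2 : Tendsto (fun r : ℝ => (|R| * r⁻¹ + 1) ^ d * unitBallVolume d) atTop
      (𝓝 (unitBallVolume d)) := by
    simpa using (((hinv.const_mul |R|).add_const 1).pow d).mul_const (unitBallVolume d)
  have h3 : unitBallVolume d * V 0 ≤ unitBallVolume d := by
    refine le_of_tendsto_of_tendsto h1 h2 ?_
    filter_upwards [eventually_gt_atTop 0] with r hr
    have hle : volume.real (K + Metric.closedBall (0 : E d) r) ≤ (|R| + r) ^ d * unitBallVolume d := by
      rw [← measureReal_closedBall_eq (by positivity)]
      refine measureReal_mono ?_ (isCompact_closedBall _ _).measure_lt_top.ne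
      rintro _ ⟨x, hx, y, hy, rfl⟩
      have hx' := mem_closedBall_zero_iff.1 (hR hx)
      rw [mem_closedBall_zero_iff] at hy ⊢
      exact (norm_add_le _ _).trans (add_le_add (hx'.trans (le_abs_self R)) hy)
    rw [hV.1 r hr.le] at hle
    have hrd : 0 < r ^ d := by positivity
    refine le_of_mul_le_mul_left (le_of_eq_of_le ?_ (hle.trans_eq ?_)) hrd
    · rw [Finset.mul_sum]
      refine Finset.sum_congr rfl fun j hj => ?_
      rw [pow_sub₀ r hr.ne' (Nat.lt_succ_iff.1 (Finset.mem_range.1 hj)), inv_pow]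
      ring
    · rw [← mul_assoc, ← mul_pow]
      congr 2
      field_simp
  nlinarith [unitBallVolume_pos d]

end Coefficients

/-- A connected set with a long reach has a large parallel set. -/
theorem norm_mul_measureReal_ball_le {d : ℕ} {A : Set (E d)} (hA : IsConnected A)
    (h0 : (0 : E d) ∈ A) (hb : Bornology.IsBounded A) {x : E d} (hx : x ∈ A) :
    ‖x‖ * volume.real (Metric.ball (0 : E d) (1 / 2)) ≤
      volume.real (A + Metric.closedBall (0 : E d) 1) := by
  have hIcc : Set.Icc 0 ‖x‖ ⊆ norm '' A :=
    (hA.isPreconnected.image norm continuous_norm.continuousOn).Icc_subset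
      ⟨0, h0, norm_zero⟩ ⟨x, hx, rfl⟩
  set N := ⌊‖x‖⌋₊ with hN
  -- Connectedness supplies a point at every integer norm up to `‖x‖`. These points are at mutual
  -- distance at least one, so the balls of radius `1 / 2` around them are disjoint.
  have hex : ∀ j ∈ Finset.range (N + 1), ∃ y ∈ A, ‖y‖ = (j : ℝ) := fun j hj =>
    hIcc ⟨Nat.cast_nonneg j, (Nat.le_floor_iff (norm_nonneg x)).1
      (Nat.lt_succ_iff.1 (Finset.mem_range.1 hj))⟩
  choose! y hyA hy using hex
  have hdisj : Set.PairwiseDisjoint (Finset.range (N + 1) : Set ℕ)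
      fun j => Metric.ball (y j) (1 / 2) := by
    intro i hi j hj hij
    refine Metric.ball_disjoint_ball ?_
    have h1 := abs_norm_sub_norm_le (y i) (y j)
    rw [hy i hi, hy j hj, ← dist_eq_norm] at h1
    refine le_trans ?_ h1
    have : (1 : ℤ) ≤ |(i : ℤ) - j| := Int.one_le_abs (sub_ne_zero.2 (by exact_mod_cast hij))
    norm_num
    exact_mod_cast this
  have hfin : volume (A + Metric.closedBall (0 : E d) 1) ≠ ⊤ :=
    (hb.add Metric.isBounded_closedBall).measure_lt_top.ne
  have hsum := measureReal_biUnion_finset (μ := (volume : Measure (E d))) hdisj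
    (fun j _ => measurableSet_ball) (fun j _ => measure_ball_lt_top.ne)
  have hcenter : ∀ j, volume.real (Metric.ball (y j) (1 / 2)) =
      volume.real (Metric.ball (0 : E d) (1 / 2)) := fun j => by
    simp only [Measure.real, Measure.addHaar_ball_center]
  simp only [hcenter, Finset.sum_const, Finset.card_range, nsmul_eq_mul] at hsum
  have hle : ‖x‖ ≤ ((N + 1 : ℕ) : ℝ) := by
    push_cast
    exact (Nat.lt_floor_add_one ‖x‖).le
  refine (mul_le_mul_of_nonneg_right hle measureReal_nonneg).trans ?_
  rw [← hsum]
  refine measureReal_mono (Set.iUnion₂_subset fun j hj z hz => ?_) hfin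
  refine ⟨y j, hyA j hj, z - y j, ?_, by simp⟩
  rw [mem_closedBall_zero_iff, ← dist_eq_norm]
  linarith [Metric.mem_ball.1 hz]

/-! ### The box condition and the intrinsic volumes -/

section Equivalence

variable {d p : ℕ} {D : ℕ → Set (Fin d → ℤ)} {C : ℕ → Fin p → Set (E d)} {c : ℕ → Fin d → ℝ}

theorem IsConvexBody.nonempty {K : Set (E d)} (hK : IsConvexBody K) : K.Nonempty :=
  hK.interior_nonempty.mono interior_subset

/-- In dimension zero the whole space has finite volume, so the volumes cannot diverge. -/
theorem IsScaledIndexSet.dim_ne_zero (h : IsScaledIndexSet D C c) : d ≠ 0 := by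
  rintro rfl
  obtain ⟨n, hn⟩ := (h.volume_tendsto.eventually_gt_atTop
    (volume.real (Set.univ : Set (E 0)))).exists
  refine absurd (measureReal_mono (Set.subset_univ _) ?_) (not_le.2 hn)
  exact (Set.toFinite _).isCompact.measure_lt_top.ne

theorem IsScaledIndexSet.exists_isSteiner (h : IsScaledIndexSet D C c) (n : ℕ) (i : Fin p)
    (r : Fin d → ℝ) : ∃ V, IsSteiner (coordScale r (C n i)) V :=
  SpatialIndex.exists_isSteiner h.dim_ne_zero (convex_coordScale (h.convexBody n i).convex _)
    (isCompact_coordScale (h.convexBody n i).isCompact _) ((h.convexBody n i).nonempty.image _)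

theorem IsScaledIndexSet.isCompact_iUnion (h : IsScaledIndexSet D C c) (n : ℕ) :
    IsCompact (⋃ i, C n i) :=
  _root_.isCompact_iUnion fun i => (h.convexBody n i).isCompact

theorem IsScaledIndexSet.intrinsicVolumesBounded (h : IsScaledIndexSet D C c)
    (hB : BoxContained C c) : IntrinsicVolumesBounded C c := by
  obtain ⟨b, -, hb⟩ := hB
  intro j _ _
  obtain ⟨M, hM⟩ := exists_abs_steiner_le d b j
  refine ⟨∑ _i : Fin p, M, fun n => (Finset.abs_sum_le_sum_abs _ _).trans
    (Finset.sum_le_sum fun i _ => ?_)⟩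
  obtain ⟨V, hV⟩ := h.exists_isSteiner n i fun l => (c n l)⁻¹
  rw [hV.intrinsicVolume_eq]
  refine hM _ V ?_ hV
  rw [← subset_coordScale_iff (h.scale_pos n)]
  exact (Set.subset_iUnion _ i).trans (hb n)

theorem IsScaledIndexSet.tendsto_measureReal_scaled (h : IsScaledIndexSet D C c) :
    Tendsto (fun n => volume.real (coordScale (fun l => (c n l)⁻¹) (⋃ i, C n i))) atTop (𝓝 1) := by
  have hne : ∀ᶠ n in atTop, volume.real (⋃ i, C n i) ≠ 0 :=
    h.volume_tendsto.eventually_ne_atTop 0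
  have hne' : ∀ᶠ n in atTop, ∏ l, c n l ≠ 0 :=
    Eventually.of_forall fun n => (Finset.prod_pos fun l _ => h.scale_pos n l).ne'
  have := (isEquivalent_iff_tendsto_one hne').1 h.prod_equiv.symm
  refine this.congr fun n => ?_
  rw [measureReal_coordScale fun l => inv_pos.2 (h.scale_pos n l), Finset.prod_inv_distrib,
    Pi.div_apply, div_eq_inv_mul]

theorem IsScaledIndexSet.boxContained (h : IsScaledIndexSet D C c)
    (hconn : ∀ n, IsConnected (⋃ i, C n i)) (h0 : ∀ n, 0 ∈ D n)
    (hV : IntrinsicVolumesBounded C c) : BoxContained C c := by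
  let K : ℕ → Fin p → Set (E d) := fun n i => coordScale (fun l => (c n l)⁻¹) (C n i)
  have hKc : ∀ n i, IsCompact (K n i) := fun n i =>
    isCompact_coordScale (h.convexBody n i).isCompact _
  have hUc : ∀ n, IsCompact (⋃ i, K n i) := fun n => _root_.isCompact_iUnion (hKc n)
  obtain ⟨S, hS⟩ := h.tendsto_measureReal_scaled.bddAbove_range
  have hSn : ∀ n, volume.real (⋃ i, K n i) ≤ S := fun n => by
    rw [← coordScale_iUnion]; exact hS ⟨n, rfl⟩
  -- The end indices are not covered by (V): `V_0` is at most one for each piece, and `V_d` is at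
  -- most the volume of the scaled union.
  have hM : ∀ j, ∃ M : ℝ, j ∈ Finset.range (d + 1) → ∀ n, ∑ i, intrinsicVolume j (K n i) ≤ M := by
    intro j
    rcases Nat.eq_zero_or_pos j with rfl | hj
    · refine ⟨∑ _i : Fin p, 1, fun _ n => Finset.sum_le_sum fun i _ => ?_⟩
      obtain ⟨V, hV⟩ := h.exists_isSteiner n i fun l => (c n l)⁻¹
      rw [hV.intrinsicVolume_eq]
      exact hV.apply_zero_le_one (hKc n i).isBounded
    rcases lt_trichotomy j d with hjd | rfl | hjd
    · obtain ⟨M, hM⟩ := hV j hj hjd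
      exact ⟨M, fun _ n => (le_abs_self _).trans (hM n)⟩
    · refine ⟨∑ _i : Fin p, S, fun _ n => Finset.sum_le_sum fun i _ => ?_⟩
      obtain ⟨V, hV⟩ := h.exists_isSteiner n i fun l => (c n l)⁻¹
      rw [hV.intrinsicVolume_eq, hV.apply_dim]
      exact (measureReal_mono (Set.subset_iUnion (K n) i) (hUc n).measure_lt_top.ne).trans (hSn n)
    · exact ⟨0, fun hj' => by have := Finset.mem_range.1 hj'; omega⟩
  choose M hM using hM
  let T : ℝ := ∑ j ∈ Finset.range (d + 1), unitBallVolume (d - j) * M j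
  have hT : ∀ n, volume.real ((⋃ i, K n i) + Metric.closedBall (0 : E d) 1) ≤ T := by
    intro n
    rw [Set.iUnion_add]
    refine (measureReal_iUnion_fintype_le _).trans ?_
    have h1 : ∀ i, volume.real (K n i + Metric.closedBall (0 : E d) 1) =
        ∑ j ∈ Finset.range (d + 1), unitBallVolume (d - j) * intrinsicVolume j (K n i) := by
      intro i
      obtain ⟨V, hV⟩ := h.exists_isSteiner n i fun l => (c n l)⁻¹
      rw [hV.1 1 zero_le_one]
      exact Finset.sum_congr rfl fun j _ => by rw [hV.intrinsicVolume_eq, one_pow, mul_one]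
    simp only [h1]
    rw [Finset.sum_comm]
    refine Finset.sum_le_sum fun j hj => ?_
    rw [← Finset.mul_sum]
    exact mul_le_mul_of_nonneg_left (hM j hj n) (unitBallVolume_pos _).le
  clear_value T
  set κ := volume.real (Metric.ball (0 : E d) (1 / 2)) with hκ
  have hκ0 : 0 < κ := ENNReal.toReal_pos (Metric.measure_ball_pos _ _ (by norm_num)).ne'
    measure_ball_lt_top.ne
  have hT0 : 0 ≤ T := measureReal_nonneg.trans (hT 0)
  -- The quotient `T / κ` already bounds the norms; the added one only makes the constant positive.
  refine ⟨T / κ + 1, add_pos_of_nonneg_of_pos (div_nonneg hT0 hκ0.le) one_pos, fun n => ?_⟩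
  rw [subset_coordScale_iff (h.scale_pos n)]
  refine Set.Subset.trans (fun x hx => ?_) (closedBall_subset_cube d _)
  have hU : coordScale (fun l => (c n l)⁻¹) (⋃ i, C n i) = ⋃ i, K n i := coordScale_iUnion _ _
  have hconn' : IsConnected (⋃ i, K n i) := by
    rw [← hU]
    exact isConnected_coordScale (hconn n) _
  have h0' : (0 : E d) ∈ ⋃ i, K n i := by
    have h1 := h0 n
    rw [h.lattice_eq n] at h1
    rw [← hU]
    refine ⟨_, h1, ?_⟩
    ext l
    simp
  rw [hU] at hx
  rw [mem_closedBall_zero_iff]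
  have := (norm_mul_measureReal_ball_le hconn' h0' (hUc n).isBounded hx).trans (hT n)
  rw [← le_div_iff₀ hκ0] at this
  linarith

end Equivalence

/-! ### Grid boxes -/

section Grid

variable {d : ℕ} {t : Fin d → ℤ}

theorem mem_gridBox_iff (ht : ∀ l, 0 < t l) {z : Fin d → ℤ} {x : E d} :
    x ∈ gridBox t z ↔ ∀ l, ⌊x l / t l⌋ = z l := by
  refine forall_congr' fun l => ?_
  have h : (0 : ℝ) < t l := by exact_mod_cast ht l
  rw [Int.floor_eq_iff, le_div_iff₀ h, div_lt_iff₀ h, Set.mem_Ico]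

theorem pairwise_disjoint_gridBox (ht : ∀ l, 0 < t l) :
    Pairwise fun z w : Fin d → ℤ => Disjoint (gridBox t z) (gridBox t w) := by
  intro z w hzw
  rw [Set.disjoint_left]
  intro x hz hw
  exact hzw (funext fun l => ((mem_gridBox_iff ht).1 hz l).symm.trans ((mem_gridBox_iff ht).1 hw l))

theorem gridBox_nonempty (ht : ∀ l, 0 < t l) (z : Fin d → ℤ) : (gridBox t z).Nonempty := by
  refine ⟨WithLp.toLp 2 fun l => (z l : ℝ) * t l, (mem_gridBox_iff ht).2 fun l => ?_⟩
  have h : (t l : ℝ) ≠ 0 := by exact_mod_cast (ht l).ne'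
  simp [h]

theorem innerIndices_subset_outerIndices (ht : ∀ l, 0 < t l) (A : Set (E d)) :
    innerIndices t A ⊆ outerIndices t A := fun z hz =>
  let ⟨x, hx⟩ := gridBox_nonempty ht z
  ⟨x, hx, hz hx⟩

theorem gridBox_eq_preimage (t z : Fin d → ℤ) :
    gridBox t z = (MeasurableEquiv.toLp 2 (Fin d → ℝ)).symm ⁻¹'
      (Set.univ.pi fun l => Set.Ico ((z l : ℝ) * t l) (((z l : ℝ) + 1) * t l)) := by
  ext x
  simp [gridBox]

theorem measurableSet_gridBox (t z : Fin d → ℤ) : MeasurableSet (gridBox t z) := by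
  rw [gridBox_eq_preimage]
  exact (MeasurableEquiv.measurable _) (MeasurableSet.univ_pi fun _ => measurableSet_Ico)

theorem volume_gridBox (t z : Fin d → ℤ) :
    volume (gridBox t z) = ∏ l, ENNReal.ofReal (t l) := by
  rw [gridBox_eq_preimage,
    (EuclideanSpace.volume_preserving_symm_measurableEquiv_toLp (Fin d)).measure_preimage
    (MeasurableSet.univ_pi fun _ => measurableSet_Ico).nullMeasurableSet, Real.volume_pi_Ico]
  congr 1
  ext l
  congr 1
  ring

theorem measureReal_gridBox (ht : ∀ l, 0 < t l) (z : Fin d → ℤ) :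
    volume.real (gridBox t z) = ∏ l, (t l : ℝ) := by
  rw [Measure.real, volume_gridBox, ENNReal.toReal_prod]
  exact Finset.prod_congr rfl fun l _ => ENNReal.toReal_ofReal (by exact_mod_cast (ht l).le)

theorem measureReal_biUnion_gridBox (ht : ∀ l, 0 < t l) (S : Finset (Fin d → ℤ)) :
    volume.real (⋃ z ∈ S, gridBox t z) = S.card * ∏ l, (t l : ℝ) := by
  rw [measureReal_biUnion_finset (fun z _ w _ h => pairwise_disjoint_gridBox ht h)
    (fun z _ => measurableSet_gridBox t z) (fun z _ => by
      rw [volume_gridBox]; exact ENNReal.prod_ne_top fun _ _ => ENNReal.ofReal_ne_top)]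
  simp [measureReal_gridBox ht]

/-- The range of the `l`-th coordinate of the indices of the boxes that meet `c [-b, b]^d`. -/
def indexRange (t : Fin d → ℤ) (c : Fin d → ℝ) (b : ℝ) (l : Fin d) : Finset ℤ :=
  Finset.Icc ⌊-(c l * b) / t l⌋ ⌊c l * b / t l⌋

theorem abs_le_of_mem_coordScale_cube {c : Fin d → ℝ} (hc : ∀ l, 0 < c l) {b : ℝ} {x : E d}
    (hx : x ∈ coordScale c (cube d b)) (l : Fin d) : |x l| ≤ c l * b := by
  obtain ⟨a, ha, rfl⟩ := hx
  simp only [abs_mul, abs_of_pos (hc l)]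
  exact mul_le_mul_of_nonneg_left (abs_le.2 (ha l)) (hc l).le

theorem outerIndices_subset_piFinset (ht : ∀ l, 0 < t l) {c : Fin d → ℝ} (hc : ∀ l, 0 < c l)
    {b : ℝ} {A : Set (E d)} (hA : A ⊆ coordScale c (cube d b)) :
    outerIndices t A ⊆ Fintype.piFinset (indexRange t c b) := by
  rintro z ⟨x, hx, hxA⟩
  rw [Finset.mem_coe, Fintype.mem_piFinset]
  intro l
  have h : (0 : ℝ) < t l := by exact_mod_cast ht l
  have hx' := abs_le.1 (abs_le_of_mem_coordScale_cube hc (hA hxA) l)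
  rw [← (mem_gridBox_iff ht).1 hx l, indexRange, Finset.mem_Icc]
  exact ⟨Int.floor_mono (div_le_div_of_nonneg_right hx'.1 h.le),
    Int.floor_mono (div_le_div_of_nonneg_right hx'.2 h.le)⟩

theorem card_indexRange_le (ht : ∀ l, 0 < t l) {c : Fin d → ℝ} (hc : ∀ l, 0 < c l) {b : ℝ}
    (hb : 0 < b) (l : Fin d) :
    ((indexRange t c b l).card : ℝ) ≤ 2 * b * (c l / t l) + 2 := by
  have h : (0 : ℝ) < t l := by exact_mod_cast ht l
  have hβ : 0 < c l * b / t l := by have := hc l; positivity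
  have h1 := Int.floor_le (c l * b / t l)
  have h2 := Int.lt_floor_add_one (-(c l * b) / t l)
  rw [neg_div] at h2
  have h3 : 0 ≤ ⌊c l * b / t l⌋ + 1 - ⌊-(c l * b) / t l⌋ := by
    have : ⌊-(c l * b) / t l⌋ ≤ ⌊c l * b / t l⌋ := Int.floor_mono (by rw [neg_div]; linarith)
    omega
  have h4 : ((indexRange t c b l).card : ℝ) =
      ((⌊c l * b / t l⌋ + 1 - ⌊-(c l * b) / t l⌋ : ℤ) : ℝ) := by
    rw [indexRange, Int.card_Icc, ← Int.cast_natCast, Int.toNat_of_nonneg h3]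
  rw [h4]
  push_cast
  rw [neg_div]
  have h5 : 2 * b * (c l / t l) = 2 * (c l * b / t l) := by ring
  linarith

/-! ### Boxes at the boundary of a convex set -/

/-- If a box meets the convex set `K` without being contained in it, then in some coordinate
direction, no box at distance at least `d` in this direction meets `K`. -/
theorem exists_direction (ht : ∀ l, 0 < t l) {K : Set (E d)} (hK : Convex ℝ K) (hcl : IsClosed K)
    {z : Fin d → ℤ} (hz : z ∈ outerIndices t K \ innerIndices t K) :
    ∃ l, ∃ σ : ℤ, (σ = 1 ∨ σ = -1) ∧ ∀ z' ∈ outerIndices t K, (∀ j, j ≠ l → z' j = z j) →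
      ¬ (d : ℤ) ≤ σ * (z' l - z l) := by
  obtain ⟨⟨w, hw, hwK⟩, hzi⟩ := hz
  obtain ⟨y, hy, hyK⟩ := Set.not_subset.1 hzi
  obtain ⟨f, s, hs, hsy⟩ := geometric_hahn_banach_closed_point hK hcl hyK
  set u : Fin d → ℝ := fun l => f (EuclideanSpace.single l 1) with hu
  have hf : ∀ x, f x = ∑ l, x l * u l := by
    intro x
    conv_lhs => rw [← (EuclideanSpace.basisFun (Fin d) ℝ).sum_repr x]
    simp [hu]
  have hd : (Finset.univ : Finset (Fin d)).Nonempty := by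
    by_contra hne
    rw [Finset.not_nonempty_iff_eq_empty] at hne
    have h1 := (hs w hwK).trans hsy
    rw [hf, hf, hne] at h1
    simp at h1
  -- The functional varies by at most `|u j| * t j` along side `j` of a box. With `l` maximal, a
  -- shift by `d` boxes along `l` outweighs the variation over all `d` sides together.
  obtain ⟨l, -, hl⟩ := Finset.exists_max_image Finset.univ (fun l => |u l| * t l) hd
  obtain ⟨σ, hσ, hσu⟩ : ∃ σ : ℤ, (σ = 1 ∨ σ = -1) ∧ (σ : ℝ) * |u l| = u l := by
    rcases le_total 0 (u l) with h | h
    · exact ⟨1, Or.inl rfl, by simp [abs_of_nonneg h]⟩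
    · exact ⟨-1, Or.inr rfl, by simp [abs_of_nonpos h]⟩
  refine ⟨l, σ, hσ, ?_⟩
  rintro z' ⟨x, hx, hxK⟩ hj hm
  have hlt := (hs x hxK).trans hsy
  rw [hf, hf, ← sub_pos, ← Finset.sum_sub_distrib] at hlt
  have htpos : ∀ j, (0 : ℝ) < t j := fun j => by exact_mod_cast ht j
  have hbound : ∀ j, y j * u j - x j * u j ≤
      |u j| * t j - (z' j - z j) * t j * u j := by
    intro j
    obtain ⟨x1, x2⟩ := hx j
    obtain ⟨y1, y2⟩ := hy j
    have h1 : |y j - x j + (z' j - z j) * t j| ≤ t j := by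
      rw [abs_le]; constructor <;> nlinarith
    have h2 : (y j - x j + (z' j - z j) * t j) * u j ≤ t j * |u j| := by
      refine (le_abs_self _).trans ?_
      rw [abs_mul]
      exact mul_le_mul_of_nonneg_right h1 (abs_nonneg _)
    linarith
  have hshift : ∑ j, ((z' j : ℝ) - z j) * t j * u j = (z' l - z l) * t l * u l :=
    Finset.sum_eq_single l (fun j _ hjl => by rw [hj j hjl]; ring) (by simp)
  have hsum : ∑ j, (y j * u j - x j * u j) ≤
      d * (|u l| * t l) - (z' l - z l) * t l * u l := by
    refine (Finset.sum_le_sum fun j _ => hbound j).trans ?_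
    rw [Finset.sum_sub_distrib, hshift]
    refine sub_le_sub_right ?_ _
    simpa using Finset.sum_le_card_nsmul Finset.univ _ _ hl
  have hm' : (d : ℝ) ≤ σ * (z' l - z l) := by exact_mod_cast hm
  have h3 : ((z' l : ℝ) - z l) * t l * u l = (σ * (z' l - z l)) * (|u l| * t l) := by
    rw [← hσu, abs_mul, abs_abs]
    rcases hσ with rfl | rfl <;> simp <;> ring
  rw [h3] at hsum
  have h4 := mul_le_mul_of_nonneg_right hm' (mul_nonneg (abs_nonneg (u l)) (htpos l).le)
  linarith

/-- Reducing coordinate `l` modulo `d` is injective on `S`: two points that agree elsewhere and are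
congruent there differ by a multiple of `d`, which separation forces to be zero. -/
theorem card_le_of_separated_in_direction {S : Finset (Fin d → ℤ)} {I : Fin d → Finset ℤ}
    (hSI : S ⊆ Fintype.piFinset I) (l : Fin d) {σ : ℤ} (hσ : σ = 1 ∨ σ = -1)
    (hsep : ∀ z ∈ S, ∀ z' ∈ S, (∀ j, j ≠ l → z' j = z j) → ¬ (d : ℤ) ≤ σ * (z' l - z l)) :
    S.card ≤ d * ∏ j ∈ Finset.univ.erase l, (I j).card := by
  classical
  have hd : (0 : ℤ) < d := by exact_mod_cast l.pos
  have hcard : (Fintype.piFinset (Function.update I l (Finset.Ico 0 (d : ℤ)))).card =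
      d * ∏ j ∈ Finset.univ.erase l, (I j).card := by
    rw [Fintype.card_piFinset, ← Finset.mul_prod_erase _ _ (Finset.mem_univ l)]
    congr 1
    · simp
    · exact Finset.prod_congr rfl fun j hj => by
        rw [Function.update_of_ne (Finset.ne_of_mem_erase hj)]
  rw [← hcard]
  refine Finset.card_le_card_of_injOn (fun z => Function.update z l (z l % d)) ?_ ?_
  · intro z hz
    have hz' := Fintype.mem_piFinset.1 (hSI hz)
    rw [Finset.mem_coe, Fintype.mem_piFinset]
    intro j
    rcases eq_or_ne j l with rfl | hjl
    · simpa using ⟨Int.emod_nonneg _ hd.ne', Int.emod_lt_of_pos _ hd⟩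
    · simpa [hjl] using hz' j
  · intro z hz w hw hzw
    have hoff : ∀ j, j ≠ l → w j = z j := fun j hj => by
      have := congrFun hzw j
      simpa [hj] using this.symm
    have hmod : z l % d = w l % d := by simpa using congrFun hzw l
    have h1 := hsep z hz w hw hoff
    have h2 := hsep w hw z hz fun j hj => (hoff j hj).symm
    obtain ⟨q, hq⟩ := Int.ModEq.dvd hmod
    have hq0 : q = 0 := by
      have hq' : z l - w l = d * -q := by linarith
      rw [hq] at h1
      rw [hq'] at h2
      by_contra hne
      rcases lt_or_gt_of_ne hne with h | h
      · rcases hσ with rfl | rfl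
        · exact h2 (by nlinarith)
        · exact h1 (by nlinarith)
      · rcases hσ with rfl | rfl
        · exact h1 (by nlinarith)
        · exact h2 (by nlinarith)
    rw [hq0, mul_zero, sub_eq_zero] at hq
    funext j
    rcases eq_or_ne j l with rfl | hj
    · exact hq.symm
    · exact (hoff j hj).symm

open Classical in
-- The boundary boxes are sorted by the direction and sign from `exists_direction`; each class is
-- separated in its direction.
theorem ncard_outer_sdiff_inner_le (ht : ∀ l, 0 < t l) {K : Set (E d)} (hK : Convex ℝ K)
    (hcl : IsClosed K) {I : Fin d → Finset ℤ} (hI : outerIndices t K ⊆ Fintype.piFinset I) :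
    (outerIndices t K \ innerIndices t K).ncard ≤
      ∑ l, 2 * (d * ∏ j ∈ Finset.univ.erase l, (I j).card) := by
  have hfin : (outerIndices t K \ innerIndices t K).Finite :=
    ((Finset.finite_toSet _).subset hI).subset Set.sdiff_subset
  let P : Fin d → ℤ → (Fin d → ℤ) → Prop := fun l σ z => ∀ z' ∈ outerIndices t K,
    (∀ j, j ≠ l → z' j = z j) → ¬ (d : ℤ) ≤ σ * (z' l - z l)
  have hcard : ∀ l σ, (σ = 1 ∨ σ = -1) → (hfin.toFinset.filter (P l σ)).card ≤
      d * ∏ j ∈ Finset.univ.erase l, (I j).card := by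
    intro l σ hσ
    refine card_le_of_separated_in_direction (fun z hz => ?_) l hσ fun z hz z' hz' => ?_
    · exact Finset.mem_coe.1 (hI (hfin.mem_toFinset.1 (Finset.mem_filter.1 hz).1).1)
    · exact (Finset.mem_filter.1 hz).2 z' (hfin.mem_toFinset.1 (Finset.mem_filter.1 hz').1).1
  have hcover : hfin.toFinset ⊆ Finset.univ.biUnion fun l =>
      hfin.toFinset.filter (P l 1) ∪ hfin.toFinset.filter (P l (-1)) := by
    intro z hz
    obtain ⟨l, σ, hσ, hP⟩ := exists_direction ht hK hcl (hfin.mem_toFinset.1 hz)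
    refine Finset.mem_biUnion.2 ⟨l, Finset.mem_univ l, ?_⟩
    rcases hσ with rfl | rfl
    · exact Finset.mem_union_left _ (Finset.mem_filter.2 ⟨hz, hP⟩)
    · exact Finset.mem_union_right _ (Finset.mem_filter.2 ⟨hz, hP⟩)
  rw [Set.ncard_eq_toFinset_card _ hfin]
  refine (Finset.card_le_card hcover).trans (Finset.card_biUnion_le.trans
    (Finset.sum_le_sum fun l _ => (Finset.card_union_le _ _).trans ?_))
  have h1 := hcard l 1 (Or.inl rfl)
  have h2 := hcard l (-1) (Or.inr rfl)
  omega

theorem outer_sdiff_inner_iUnion_subset {ι : Type*} (t : Fin d → ℤ) (K : ι → Set (E d)) :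
    outerIndices t (⋃ i, K i) \ innerIndices t (⋃ i, K i) ⊆
      ⋃ i, outerIndices t (K i) \ innerIndices t (K i) := by
  rintro z ⟨⟨x, hx, hxK⟩, hz⟩
  obtain ⟨i, hi⟩ := Set.mem_iUnion.1 hxK
  exact Set.mem_iUnion.2 ⟨i, ⟨x, hx, hi⟩, fun h => hz (h.trans (Set.subset_iUnion K i))⟩

end Grid

/-! ### Counting boxes in unions of convex sets -/

section Counting

variable {d p : ℕ}

theorem finite_outerIndices {t : Fin d → ℤ} (ht : ∀ l, 0 < t l) {c : Fin d → ℝ}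
    (hc : ∀ l, 0 < c l) {b : ℝ} {A : Set (E d)} (hA : A ⊆ coordScale c (cube d b)) :
    (outerIndices t A).Finite :=
  (Finset.finite_toSet _).subset (outerIndices_subset_piFinset ht hc hA)

theorem ncard_innerIndices_mul_le {t : Fin d → ℤ} (ht : ∀ l, 0 < t l) {A : Set (E d)}
    (hfin : (outerIndices t A).Finite) (hA : volume A ≠ ⊤) :
    (innerIndices t A).ncard * ∏ l, (t l : ℝ) ≤ volume.real A := by
  have hfin' := hfin.subset (innerIndices_subset_outerIndices ht A)
  rw [Set.ncard_eq_toFinset_card _ hfin', ← measureReal_biUnion_gridBox ht]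
  exact measureReal_mono (Set.iUnion₂_subset fun z hz => hfin'.mem_toFinset.1 hz) hA

theorem le_ncard_outerIndices_mul {t : Fin d → ℤ} (ht : ∀ l, 0 < t l) {A : Set (E d)}
    (hfin : (outerIndices t A).Finite) :
    volume.real A ≤ (outerIndices t A).ncard * ∏ l, (t l : ℝ) := by
  rw [Set.ncard_eq_toFinset_card _ hfin, ← measureReal_biUnion_gridBox ht]
  refine measureReal_mono (fun x hx => ?_) ?_
  · have hxz : x ∈ gridBox t fun l => ⌊x l / t l⌋ := (mem_gridBox_iff ht).2 fun l => rfl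
    exact Set.mem_iUnion₂.2 ⟨_, hfin.mem_toFinset.2 ⟨x, hxz, hx⟩, hxz⟩
  · refine (measure_biUnion_lt_top (Finset.finite_toSet _) fun z _ => ?_).ne
    rw [volume_gridBox]
    exact ENNReal.prod_lt_top fun _ _ => ENNReal.ofReal_lt_top

/-- A range of indices has order `c j / t j`, which the normalising product cancels. Direction `l`
contributes no range to the boundary count, so a factor `t l / c l` survives, and this makes the
error vanish in the limit. -/
theorem ncard_outer_sub_inner_mul_le {t : Fin d → ℤ} (ht : ∀ l, 0 < t l) {c : Fin d → ℝ}
    (hc : ∀ l, 0 < c l) {b : ℝ} (hb : 0 < b) {K : Fin p → Set (E d)}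
    (hK : ∀ i, IsConvexBody (K i)) (hKb : (⋃ i, K i) ⊆ coordScale c (cube d b)) :
    ((outerIndices t (⋃ i, K i)).ncard - (innerIndices t (⋃ i, K i)).ncard : ℝ) *
        ∏ l, ((t l : ℝ) / c l) ≤
      p * ∑ l, 2 * (d * ((t l : ℝ) / c l *
        ∏ j ∈ Finset.univ.erase l, (2 * b + 2 * ((t j : ℝ) / c j)))) := by
  have hO := finite_outerIndices ht hc hKb
  have hsub := innerIndices_subset_outerIndices ht (⋃ i, K i)
  have htc : ∀ l, 0 < (t l : ℝ) / c l := fun l => div_pos (by exact_mod_cast ht l) (hc l)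
  have h1 : (outerIndices t (⋃ i, K i)).ncard ≤ (innerIndices t (⋃ i, K i)).ncard +
      p * ∑ l, 2 * (d * ∏ j ∈ Finset.univ.erase l, (indexRange t c b j).card) := by
    rw [← Set.ncard_sdiff_add_ncard_of_subset hsub hO, add_comm]
    refine Nat.add_le_add_left ?_ _
    have hKfin : ∀ i, (outerIndices t (K i) \ innerIndices t (K i)).Finite := fun i =>
      (finite_outerIndices ht hc ((Set.subset_iUnion K i).trans hKb)).subset Set.sdiff_subset
    refine (Set.ncard_le_ncard (outer_sdiff_inner_iUnion_subset t K)
      (Set.finite_iUnion hKfin)).trans ((Set.ncard_iUnion_le_of_fintype _).trans ?_)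
    refine (Finset.sum_le_card_nsmul _ _ _ fun i _ => ncard_outer_sdiff_inner_le ht (hK i).convex
      (hK i).isCompact.isClosed (outerIndices_subset_piFinset ht hc
        ((Set.subset_iUnion K i).trans hKb))).trans ?_
    simp
  have h2 : ((outerIndices t (⋃ i, K i)).ncard - (innerIndices t (⋃ i, K i)).ncard : ℝ) ≤
      p * ∑ l, 2 * (d * ∏ j ∈ Finset.univ.erase l, ((indexRange t c b j).card : ℝ)) := by
    rw [sub_le_iff_le_add']
    exact_mod_cast h1
  refine (mul_le_mul_of_nonneg_right h2 (Finset.prod_nonneg fun l _ => (htc l).le)).trans ?_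
  rw [mul_assoc, Finset.sum_mul]
  refine mul_le_mul_of_nonneg_left (Finset.sum_le_sum fun l _ => ?_) (Nat.cast_nonneg p)
  rw [mul_assoc, mul_assoc]
  refine mul_le_mul_of_nonneg_left (mul_le_mul_of_nonneg_left ?_ (Nat.cast_nonneg d)) two_pos.le
  rw [← Finset.mul_prod_erase Finset.univ _ (Finset.mem_univ l), mul_left_comm,
    ← Finset.prod_mul_distrib]
  refine mul_le_mul_of_nonneg_left (Finset.prod_le_prod
    (fun j _ => mul_nonneg (Nat.cast_nonneg _) (htc j).le) fun j _ => ?_) (htc l).le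
  refine (mul_le_mul_of_nonneg_right (card_indexRange_le ht hc hb j) (htc j).le).trans_eq ?_
  have h3 : (c j : ℝ) ≠ 0 := (hc j).ne'
  have h4 : (t j : ℝ) ≠ 0 := by exact_mod_cast (ht j).ne'
  field_simp

variable {D : ℕ → Set (Fin d → ℤ)} {C : ℕ → Fin p → Set (E d)} {c : ℕ → Fin d → ℝ}

/-- If the boxes are negligible compared with the scale, then the numbers of boxes inside and
meeting `C_n` are both asymptotic to the volume of `C_n` divided by the volume of a box. -/
theorem IsScaledIndexSet.tendsto_ncard_mul (h : IsScaledIndexSet D C c) (hB : BoxContained C c)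
    {t : ℕ → Fin d → ℤ} (ht : ∀ᶠ n in atTop, ∀ l, 0 < t n l)
    (hlim : ∀ l, Tendsto (fun n => (t n l : ℝ) / c n l) atTop (𝓝 0)) :
    Tendsto (fun n => ((innerIndices (t n) (⋃ i, C n i)).ncard : ℝ) * ∏ l, ((t n l : ℝ) / c n l))
      atTop (𝓝 1) ∧
    Tendsto (fun n => ((outerIndices (t n) (⋃ i, C n i)).ncard : ℝ) * ∏ l, ((t n l : ℝ) / c n l))
      atTop (𝓝 1) := by
  obtain ⟨b, hb, hCb⟩ := hB
  set v : ℕ → ℝ := fun n => volume.real (coordScale (fun l => (c n l)⁻¹) (⋃ i, C n i)) with hv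
  set err : ℕ → ℝ := fun n => p * ∑ l, 2 * (d * ((t n l : ℝ) / c n l *
    ∏ j ∈ Finset.univ.erase l, (2 * b + 2 * ((t n j : ℝ) / c n j)))) with herr
  have hv1 : Tendsto v atTop (𝓝 1) := h.tendsto_measureReal_scaled
  have herr0 : Tendsto err atTop (𝓝 0) := by
    have h1 : ∀ l, Tendsto (fun n => 2 * (d * ((t n l : ℝ) / c n l *
        ∏ j ∈ Finset.univ.erase l, (2 * b + 2 * ((t n j : ℝ) / c n j))))) atTop (𝓝 0) := by
      intro l
      have h2 := (hlim l).mul (tendsto_finsetProd (Finset.univ.erase l) fun j _ =>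
        ((hlim j).const_mul 2).const_add (2 * b))
      simpa using (h2.const_mul (d : ℝ)).const_mul 2
    simpa using (tendsto_finsetSum Finset.univ fun l _ => h1 l).const_mul (p : ℝ)
  have hprod : ∀ n, (∏ l, ((t n l : ℝ) / c n l)) = (∏ l, (t n l : ℝ)) * ∏ l, (c n l)⁻¹ := by
    intro n
    rw [← Finset.prod_mul_distrib]
    simp only [div_eq_mul_inv]
  have hvn : ∀ n, v n = volume.real (⋃ i, C n i) * ∏ l, (c n l)⁻¹ := fun n => by
    rw [hv]
    simp only
    rw [measureReal_coordScale fun l => inv_pos.2 (h.scale_pos n l), mul_comm]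
  have hc0 : ∀ n, 0 ≤ ∏ l, (c n l)⁻¹ := fun n =>
    Finset.prod_nonneg fun l _ => (inv_pos.2 (h.scale_pos n l)).le
  have hlow : ∀ᶠ n in atTop, ((innerIndices (t n) (⋃ i, C n i)).ncard : ℝ) *
      ∏ l, ((t n l : ℝ) / c n l) ≤ v n := by
    filter_upwards [ht] with n hn
    rw [hprod, hvn, ← mul_assoc]
    exact mul_le_mul_of_nonneg_right (ncard_innerIndices_mul_le hn
      (finite_outerIndices hn (h.scale_pos n) (hCb n)) (h.isCompact_iUnion n).measure_lt_top.ne)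
      (hc0 n)
  have hup : ∀ᶠ n in atTop, v n ≤ ((outerIndices (t n) (⋃ i, C n i)).ncard : ℝ) *
      ∏ l, ((t n l : ℝ) / c n l) := by
    filter_upwards [ht] with n hn
    rw [hprod, hvn, ← mul_assoc]
    exact mul_le_mul_of_nonneg_right (le_ncard_outerIndices_mul hn
      (finite_outerIndices hn (h.scale_pos n) (hCb n))) (hc0 n)
  have hdiff : ∀ᶠ n in atTop, ((outerIndices (t n) (⋃ i, C n i)).ncard : ℝ) *
      ∏ l, ((t n l : ℝ) / c n l) - ((innerIndices (t n) (⋃ i, C n i)).ncard : ℝ) *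
      ∏ l, ((t n l : ℝ) / c n l) ≤ err n := by
    filter_upwards [ht] with n hn
    rw [← sub_mul]
    exact ncard_outer_sub_inner_mul_le hn (h.scale_pos n) hb (h.convexBody n) (hCb n)
  -- The scaled volume `v` lies between the two normalised counts, whose difference is at most
  -- `err`; each count is therefore squeezed.
  constructor
  · refine tendsto_of_tendsto_of_tendsto_of_le_of_le' (by simpa using hv1.sub herr0) hv1 ?_ hlow
    filter_upwards [hup, hdiff] with n h1 h2
    linarith
  · refine tendsto_of_tendsto_of_tendsto_of_le_of_le' hv1 (by simpa using hv1.add herr0) hup ?_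
    filter_upwards [hlow, hdiff] with n h1 h2
    linarith

/-- For unit boxes, the lower corner of box `z` is the lattice point `z` itself, so `D n` lies
between the inner and outer index sets. -/
theorem IsScaledIndexSet.ncard_isEquivalent (h : IsScaledIndexSet D C c) (hB : BoxContained C c) :
    (fun n => ((D n).ncard : ℝ)) ~[atTop] (fun n => volume.real (⋃ i, C n i)) := by
  have hone : ∀ l : Fin d, (0 : ℤ) < (fun _ => 1 : Fin d → ℤ) l := fun _ => one_pos
  obtain ⟨h1, h2⟩ := h.tendsto_ncard_mul hB (t := fun _ _ => 1)
    (Eventually.of_forall fun _ => hone)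
    (fun l => by simpa [Function.comp_def] using tendsto_inv_atTop_zero.comp (h.scale_tendsto l))
  obtain ⟨b, hb, hCb⟩ := hB
  have hcorner : ∀ z : Fin d → ℤ,
      (WithLp.toLp 2 (fun l => (z l : ℝ)) : E d) ∈ gridBox (fun _ => 1) z := fun z =>
    (mem_gridBox_iff hone).2 fun l => by simp
  have hDO : ∀ n, D n ⊆ outerIndices (fun _ => 1) (⋃ i, C n i) := fun n z hz => by
    rw [h.lattice_eq n] at hz
    exact ⟨_, hcorner z, hz⟩
  have hID : ∀ n, innerIndices (fun _ => 1) (⋃ i, C n i) ⊆ D n := fun n z hz => by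
    rw [h.lattice_eq n]
    exact hz (hcorner z)
  have hfin : ∀ n, (outerIndices (fun _ => 1) (⋃ i, C n i)).Finite := fun n =>
    finite_outerIndices hone (h.scale_pos n) (hCb n)
  have hpos : ∀ n, 0 ≤ ∏ l, (((1 : ℤ) : ℝ) / c n l) := fun n =>
    Finset.prod_nonneg fun l _ => by have := h.scale_pos n l; positivity
  have h3 : Tendsto (fun n => ((D n).ncard : ℝ) * ∏ l, (((1 : ℤ) : ℝ) / c n l)) atTop (𝓝 1) := by
    refine tendsto_of_tendsto_of_tendsto_of_le_of_le h1 h2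
      (fun n => mul_le_mul_of_nonneg_right ?_ (hpos n))
      (fun n => mul_le_mul_of_nonneg_right ?_ (hpos n))
    · exact Nat.cast_le.2 (Set.ncard_le_ncard (hID n) ((hfin n).subset (hDO n)))
    · exact Nat.cast_le.2 (Set.ncard_le_ncard (hDO n) (hfin n))
  refine IsEquivalent.trans ?_ h.prod_equiv
  refine (isEquivalent_iff_tendsto_one (Eventually.of_forall fun n =>
    (Finset.prod_pos fun l _ => h.scale_pos n l).ne')).2 (h3.congr fun n => ?_)
  simp [div_eq_mul_inv]

/-- Admissibility sends the argument of the floor to infinity, so rounding is asymptotically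
negligible. -/
theorem IsScaledIndexSet.tendsto_sideLength_div_mul (h : IsScaledIndexSet D C c) {k : ℕ → ℕ}
    (hk : IsAdmissible c k) (l : Fin d) :
    Tendsto (fun n => c n l / (k n : ℝ) ^ (1 / (d : ℝ))) atTop atTop ∧
    Tendsto (fun n => (sideLength (c n) (k n) l : ℝ) / c n l * (k n : ℝ) ^ (1 / (d : ℝ)))
      atTop (𝓝 1) := by
  have hkpos : ∀ n, 0 < (k n : ℝ) ^ (1 / (d : ℝ)) := fun n =>
    Real.rpow_pos_of_pos (by exact_mod_cast hk.pos n) _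
  have h1 : Tendsto (fun n => c n l / (k n : ℝ) ^ (1 / (d : ℝ))) atTop atTop := by
    have h0 := (hk.isLittleO l).tendsto_div_nhds_zero
    have h2 : Tendsto (fun n => (k n : ℝ) ^ (1 / (d : ℝ)) / c n l) atTop (𝓝[>] 0) :=
      tendsto_nhdsWithin_iff.2 ⟨h0, Eventually.of_forall fun n =>
        div_pos (hkpos n) (h.scale_pos n l)⟩
    refine (tendsto_inv_nhdsGT_zero.comp h2).congr fun n => ?_
    simp
  refine ⟨h1, ?_⟩
  have h2 := (tendsto_nat_floor_div_atTop (R := ℝ)).comp h1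
  refine h2.congr fun n => ?_
  have h3 : (0 : ℝ) ≤ c n l / (k n : ℝ) ^ (1 / (d : ℝ)) :=
    (div_pos (h.scale_pos n l) (hkpos n)).le
  have hc := (h.scale_pos n l).ne'
  have hk' := (hkpos n).ne'
  rw [Function.comp_apply, sideLength, natCast_floor_eq_intCast_floor h3]
  rw [div_div_eq_mul_div]
  ring

theorem IsScaledIndexSet.tendsto_ncard_div (h : IsScaledIndexSet D C c) (hB : BoxContained C c)
    {k : ℕ → ℕ} (hk : IsAdmissible c k) :
    Tendsto (fun n => ((innerIndices (sideLength (c n) (k n)) (⋃ i, C n i)).ncard : ℝ) / (k n : ℝ))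
      atTop (𝓝 1) ∧
    Tendsto (fun n => ((outerIndices (sideLength (c n) (k n)) (⋃ i, C n i)).ncard : ℝ) / (k n : ℝ))
      atTop (𝓝 1) := by
  have hd : (0 : ℝ) < d := by exact_mod_cast Nat.pos_of_ne_zero h.dim_ne_zero
  have hkpos : ∀ n, (0 : ℝ) < k n := fun n => by exact_mod_cast hk.pos n
  have hroot : Tendsto (fun n => (k n : ℝ) ^ (1 / (d : ℝ))) atTop atTop :=
    (tendsto_rpow_atTop (by positivity)).comp (tendsto_natCast_atTop_atTop.comp hk.tendsto)
  have ht : ∀ᶠ n in atTop, ∀ l, 0 < sideLength (c n) (k n) l := by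
    rw [eventually_all]
    intro l
    filter_upwards [(h.tendsto_sideLength_div_mul hk l).1.eventually_ge_atTop 1] with n hn
    exact Int.floor_pos.2 hn
  have hlim : ∀ l, Tendsto (fun n => (sideLength (c n) (k n) l : ℝ) / c n l) atTop (𝓝 0) := by
    intro l
    have h1 := (h.tendsto_sideLength_div_mul hk l).2.mul (tendsto_inv_atTop_zero.comp hroot)
    rw [mul_zero] at h1
    refine h1.congr fun n => ?_
    exact mul_inv_cancel_right₀ (Real.rpow_pos_of_pos (hkpos n) _).ne' _
  -- The factors `k ^ (1 / d)` over the `d` coordinates multiply to `k`, so `k` times the normalised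
  -- box volume tends to one.
  have hprod : Tendsto (fun n => (∏ l, ((sideLength (c n) (k n) l : ℝ) / c n l)) * k n)
      atTop (𝓝 1) := by
    have h1 := tendsto_finsetProd Finset.univ fun l _ => (h.tendsto_sideLength_div_mul hk l).2
    rw [Finset.prod_const_one] at h1
    refine h1.congr fun n => ?_
    rw [Finset.prod_mul_distrib, Finset.prod_const, Finset.card_univ, Fintype.card_fin,
      ← Real.rpow_natCast, ← Real.rpow_mul (hkpos n).le, one_div_mul_cancel hd.ne', Real.rpow_one]
  obtain ⟨h1, h2⟩ := h.tendsto_ncard_mul hB ht hlim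
  have key : ∀ q : ℕ → ℝ, Tendsto (fun n => q n * ∏ l, ((sideLength (c n) (k n) l : ℝ) / c n l))
      atTop (𝓝 1) → Tendsto (fun n => q n / (k n : ℝ)) atTop (𝓝 1) := by
    intro q hq
    have h3 := hq.div hprod one_ne_zero
    rw [div_one] at h3
    refine h3.congr' ?_
    filter_upwards [ht] with n hn
    have h4 : (∏ l, ((sideLength (c n) (k n) l : ℝ) / c n l)) ≠ 0 :=
      (Finset.prod_pos fun l _ => div_pos (by exact_mod_cast hn l) (h.scale_pos n l)).ne'
    rw [Pi.div_apply, mul_comm (q n), mul_div_mul_left _ _ h4]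
  exact ⟨key _ h1, key _ h2⟩

/-- Since `k ≥ 1`, a box has side at most `c n l`, so it protrudes by at most one unit of the scale.
This holds for every `n` and does not depend on `k`. -/
theorem IsScaledIndexSet.outerApprox_subset (h : IsScaledIndexSet D C c) {b : ℝ}
    {n : ℕ} (hCb : (⋃ i, C n i) ⊆ coordScale (c n) (cube d b)) {k : ℕ} (hk : 0 < k) :
    outerApprox (sideLength (c n) k) (⋃ i, C n i) ⊆
      latticePoints (coordScale (c n) (cube d (b + 1))) := by
  intro v hv
  obtain ⟨z, ⟨y, hyz, hyC⟩, hvz⟩ := Set.mem_iUnion₂.1 hv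
  refine (mem_coordScale_iff fun l => (h.scale_pos n l).ne').2 fun l => ?_
  have hc := h.scale_pos n l
  have hy := abs_le.1 (abs_le_of_mem_coordScale_cube (h.scale_pos n) (hCb hyC) l)
  obtain ⟨y1, y2⟩ := hyz l
  obtain ⟨v1, v2⟩ := hvz l
  have ht : (sideLength (c n) k l : ℝ) ≤ c n l := by
    refine (Int.floor_le _).trans (div_le_self hc.le ?_)
    exact Real.one_le_rpow (by exact_mod_cast hk) (by positivity)
  simp only at v1 v2 ⊢
  rw [Set.mem_Icc, ← abs_le, abs_mul, abs_inv, abs_of_pos hc, inv_mul_le_iff₀ hc, abs_le]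
  constructor <;> linarith

theorem IsScaledIndexSet.goodApproximation (h : IsScaledIndexSet D C c)
    (hB : BoxContained C c) : GoodApproximation D C c := by
  refine ⟨h.ncard_isEquivalent hB, fun k hk => h.tendsto_ncard_div hB hk, ?_⟩
  obtain ⟨b, hb, hCb⟩ := hB
  exact ⟨b + 1, by linarith, fun k hk n => h.outerApprox_subset (hCb n) (hk.pos n)⟩

end Counting

end SpatialIndex

end

theorem theorem2p4 {d p : ℕ} (D : ℕ → Set (Fin d → ℤ))
    (C : ℕ → Fin p → Set (SpatialIndex.E d)) (c : ℕ → Fin d → ℝ)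
    (hDC : SpatialIndex.IsScaledIndexSet D C c) :
    (SpatialIndex.BoxContained C c → SpatialIndex.GoodApproximation D C c) ∧
    (SpatialIndex.BoxContained C c → SpatialIndex.IntrinsicVolumesBounded C c) ∧
    ((∀ n, IsConnected (⋃ i, C n i)) → (∀ n, 0 ∈ D n) →
      (SpatialIndex.BoxContained C c ↔ SpatialIndex.IntrinsicVolumesBounded C c) ∧
      (SpatialIndex.IntrinsicVolumesBounded C c → SpatialIndex.GoodApproximation D C c)) :=
  ⟨fun hB => hDC.goodApproximation hB, fun hB => hDC.intrinsicVolumesBounded hB,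
    fun hconn h0 => ⟨⟨fun hB => hDC.intrinsicVolumesBounded hB,
      fun hV => hDC.boxContained hconn h0 hV⟩,
      fun hV => hDC.goodApproximation (hDC.boxContained hconn h0 hV)⟩⟩
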